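/- Let $(N,h)$ be a smooth connected $n$-dimensional Riemannian manifold, let $\mathcal H:N\times\mathbb R\to\mathbb R$ be smooth and let $\mathcal A=\mathcal A_i(x,u)\,dx^i$ be a one-form on $N$ depending smoothly on $(x,u)\in N\times\mathbb R$. Let $M=N\times\mathbb R^2$, with points $(x,u,r)$, carry the full pp-wave metric $$g=h_{ij}\,dx^i dx^j-2\,du\,dr+\mathcal H(x,u)\,du^2+2\mathcal A_i(x,u)\,du\,dx^i .$$ For $u_0,\dot u_0\in\mathbb R$ consider, for curves $x$ in $N$, the equation of motion $$D_{\dot x}\dot x^i=-h^{ik}(\mathcal A_{k,j}-\mathcal A_{j,k})\,\dot x^j\,\dot u_0-\tfrac12 h^{ik}\,(2\mathcal A_{k,u}-\mathcal H_{,k})\,\dot u_0^2\qquad(\ast)$$ where $D$ is the covariant derivative of $(N,h)$, indices after a comma denote partial derivatives, and the right-hand side is evaluated at $(x(s),u_0+s\dot u_0)$. (1) Form of the geodesics. Let $J\subseteq\mathbb R$ be an open interval containing $0$ (for instance $J=(-a,a)$) and let $\gamma=(x,u,r):J\to M$ be a $C^2$ curve with constant energy $E_\gamma=g(\dot\gamma,\dot\gamma)$,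 with $u(0)=u_0$, $r(0)=r_0$ and $\dot u(0)=\dot u_0\neq0$. Then $\gamma$ is a geodesic of $(M,g)$ if and only if the following three conditions hold: (a) $u(s)=u_0+s\,\dot u_0$ for all $s\in J$; (b) $x$ solves $(\ast)$ on $J$; (c) for all $s\in J$, $$r(s)=r_0-\frac1{2\dot u_0}\int_0^s\Big(E_\gamma-h(\dot x(\sigma),\dot x(\sigma))-\dot u_0^2\,\mathcal H(x(\sigma),u(\sigma))-2\dot u_0\,\mathcal A_i(x(\sigma),u(\sigma))\,\dot x^i(\sigma)\Big)\,d\sigma .$$ (2) Basic condition for completeness. The spacetime $(M,g)$ is geodesically complete (every inextendible geodesic, defined on an open interval, is defined on all of $\mathbb R$) if and only if, for all $u_0,\dot u_0\in\mathbb R$ (including $\dot u_0=0$), every inextendible solution of $(\ast)$, defined on an open interval, is defined on all of $\mathbb R$. -/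

import Mathlib

open Set Manifold ContDiff Bundle

noncomputable section

namespace PPWave

section Geometry

variable {E : Type*} [NormedAddCommGroup E] [NormedSpace ℝ E]
  {B : Type*} [TopologicalSpace B] (I : ModelWithCorners ℝ E B)
  {M : Type*} [TopologicalSpace M] [ChartedSpace B M]

/-- A (not necessarily positive definite) metric, given as a continuous bilinear form on each
tangent space. -/
abbrev MetricField : Type _ :=
  ∀ p : M, TangentSpace I p →L[ℝ] TangentSpace I p →L[ℝ] ℝ

/-- The coordinate basis map of the chart `φ` at `p`: the differential of `φ⁻¹` at the coordinate
point `y`, so that the `i`-th coordinate vector of the model space goes to `∂_i`. -/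
def chartFrame (p : M) (y : E) : E →L[ℝ] TangentSpace I ((extChartAt I p).symm y) :=
  mfderivWithin 𝓘(ℝ, E) I (extChartAt I p).symm (range I) y

variable {I}

/-- The components `g_{ij}` of a metric in the chart at `p`, as a function of the coordinate
point `y`: `localMetric g p y v w = g_{ij}(y) v^i w^j`. -/
def localMetric (g : MetricField I (M := M)) (p : M) (y : E) : E →L[ℝ] E →L[ℝ] ℝ :=
  let g' : E →L[ℝ] E →L[ℝ] ℝ := g ((extChartAt I p).symm y)
  let f : E →L[ℝ] E := chartFrame I p y
  g'.bilinearComp f f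

/-- Christoffel symbols of the first kind in the chart at `p`, contracted with `v` and `w`:
the covector `z ↦ ½ (∂_i g_{jk} + ∂_j g_{ik} - ∂_k g_{ij}) v^i w^j z^k`. -/
def christoffelFirst (g : MetricField I (M := M)) (p : M) (y v w : E) : E →L[ℝ] ℝ :=
  (1 / 2 : ℝ) • (fderiv ℝ (localMetric g p) y v w + fderiv ℝ (localMetric g p) y w v
    - ((fderiv ℝ (localMetric g p) y).flip v).flip w)

/-- Christoffel symbols `Γ^k_{ij} v^i w^j` of the second kind in the chart at `p`; the inverse
`g_{ij} ↦ g^{ij}` is the inverse of the isomorphism between vectors and covectors given by `g`. -/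
def christoffel (g : MetricField I (M := M)) (p : M) (y v w : E) : E :=
  (localMetric g p y).inverse (christoffelFirst g p y v w)

variable (I)

/-- The velocity `γ'(t)`, a tangent vector at `γ(t)`. -/
def velocity (γ : ℝ → M) (t : ℝ) : TangentSpace I (γ t) :=
  mfderiv 𝓘(ℝ, ℝ) I γ t (1 : ℝ)

variable {I}

/-- The covariant acceleration `D_{γ'} γ'` of a curve with respect to the Levi-Civita connection
of `g`. It is computed in the preferred chart at `γ t`, where it has the components
`c''^k + Γ^k_{ij} c'^i c'^j` with `c` the coordinate expression of `γ`. The tangent space at `γ t`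
is by construction identified with the model space through that same chart. -/
def covAccel (g : MetricField I (M := M)) (γ : ℝ → M) (t : ℝ) : TangentSpace I (γ t) :=
  let c : ℝ → E := fun s => extChartAt I (γ t) (γ s)
  (deriv (deriv c) t + christoffel g (γ t) (c t) (deriv c t) (deriv c t) : E)

/-- `γ` restricted to the open set `J` is a geodesic of `g`. -/
def IsGeodesicOn (g : MetricField I (M := M)) (γ : ℝ → M) (J : Set ℝ) : Prop :=
  ContMDiffOn 𝓘(ℝ, ℝ) I 2 γ J ∧ ∀ t ∈ J, covAccel g γ t = 0

end Geometry

section Inextendible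

/-- Nonempty open intervals of the real line, bounded or not. -/
def IsOpenInterval (J : Set ℝ) : Prop := IsOpen J ∧ J.OrdConnected ∧ J.Nonempty

/-- Let `P c J` mean that `c` restricted to `J` is a solution of some problem. Then the solution
`c` on the open interval `J` is inextendible if it does not extend to a solution on a strictly
larger open interval. -/
def IsInextendible {X : Type*} (P : (ℝ → X) → Set ℝ → Prop) (c : ℝ → X) (J : Set ℝ) : Prop :=
  IsOpenInterval J ∧ P c J ∧
    ∀ (c' : ℝ → X) (J' : Set ℝ), IsOpenInterval J' → J ⊆ J' → P c' J' → EqOn c c' J → J' = J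

/-- All inextendible solutions are complete, that is, defined on the whole real line. -/
def AllInextendibleComplete {X : Type*} (P : (ℝ → X) → Set ℝ → Prop) : Prop :=
  ∀ (c : ℝ → X) (J : Set ℝ), IsInextendible P c J → J = univ

end Inextendible

section Spacetime

variable {n : ℕ} {N : Type*} [TopologicalSpace N] [ChartedSpace (EuclideanSpace ℝ (Fin n)) N]

/-- The model of the spacetime `M = N × ℝ²`, with points `(x, (u, r))`. -/
abbrev spacetimeModel (n : ℕ) : ModelWithCorners ℝ (EuclideanSpace ℝ (Fin n) × (ℝ × ℝ))
    (ModelProd (EuclideanSpace ℝ (Fin n)) (ModelProd ℝ ℝ)) :=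
  (𝓡 n).prod (𝓘(ℝ, ℝ).prod 𝓘(ℝ, ℝ))

/-- A `u`-dependent one-form `A = A_i(x, u) dx^i` on `N`. -/
abbrev OneForm (n : ℕ) (N : Type*) [TopologicalSpace N]
    [ChartedSpace (EuclideanSpace ℝ (Fin n)) N] : Type _ :=
  ∀ x : N, ℝ → (TangentSpace (𝓡 n) x →L[ℝ] ℝ)

/-- Smoothness of a `u`-dependent one-form in `(x, u)`, as a map into the cotangent bundle. -/
def OneForm.IsSmooth [IsManifold (𝓡 n) ∞ N] (A : OneForm n N) : Prop :=
  ContMDiff ((𝓡 n).prod 𝓘(ℝ, ℝ)) ((𝓡 n).prod 𝓘(ℝ, EuclideanSpace ℝ (Fin n) →L[ℝ] ℝ)) ∞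
    (fun p : N × ℝ => TotalSpace.mk' (EuclideanSpace ℝ (Fin n) →L[ℝ] ℝ)
      (E := fun x : N => TangentSpace (𝓡 n) x →L[ℝ] ℝ) p.1 (A p.1 p.2))

/-- The full pp-wave metric
`ds² = h_{ij} dx^i dx^j - 2 du dr + H(x,u) du² + 2 A_i(x,u) du dx^i` on `N × ℝ²`; evaluated on
tangent vectors it is the expression in `ppMetric_apply` below. -/
def ppMetric (h : MetricField (𝓡 n) (M := N)) (H : N × ℝ → ℝ) (A : OneForm n N) :
    MetricField (spacetimeModel n) (M := N × (ℝ × ℝ)) := fun p =>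
  let V := EuclideanSpace ℝ (Fin n)
  let dx : V × (ℝ × ℝ) →L[ℝ] V := .fst ℝ V (ℝ × ℝ)
  let du : V × (ℝ × ℝ) →L[ℝ] ℝ := (ContinuousLinearMap.fst ℝ ℝ ℝ).comp (.snd ℝ V (ℝ × ℝ))
  let dr : V × (ℝ × ℝ) →L[ℝ] ℝ := (ContinuousLinearMap.snd ℝ ℝ ℝ).comp (.snd ℝ V (ℝ × ℝ))
  let hx : V →L[ℝ] V →L[ℝ] ℝ := h p.1
  let Ax : V →L[ℝ] ℝ := A p.1 p.2.1
  let α : V × (ℝ × ℝ) →L[ℝ] ℝ := Ax.comp dx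
  (hx.bilinearComp dx dx - (du.smulRight dr + dr.smulRight du)
    + H (p.1, p.2.1) • du.smulRight du + (du.smulRight α + α.smulRight du) :
      V × (ℝ × ℝ) →L[ℝ] V × (ℝ × ℝ) →L[ℝ] ℝ)

theorem ppMetric_apply (h : MetricField (𝓡 n) (M := N)) (H : N × ℝ → ℝ) (A : OneForm n N)
    (x : N) (u r : ℝ) (X X' : TangentSpace (𝓡 n) x) (U U' R R' : ℝ) :
    ppMetric h H A (x, (u, r)) (X, (U, R)) (X', (U', R')) =
      h x X X' - (U * R' + R * U') + H (x, u) * (U * U') + (U * A x u X' + A x u X * U') := by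
  rfl

/-- The components `A_k(y, u)` of the one-form `A(·, u)` in the chart at `p`. -/
def localForm (A : OneForm n N) (p : N) (u : ℝ) (y : EuclideanSpace ℝ (Fin n)) :
    EuclideanSpace ℝ (Fin n) →L[ℝ] ℝ :=
  let A' : EuclideanSpace ℝ (Fin n) →L[ℝ] ℝ := A ((extChartAt (𝓡 n) p).symm y) u
  let f : EuclideanSpace ℝ (Fin n) →L[ℝ] EuclideanSpace ℝ (Fin n) := chartFrame (𝓡 n) p y
  A'.comp f

/-- The covector `z ↦ (∂_j A_k - ∂_k A_j) v^j z^k = (A_{k,j} - A_{j,k}) v^j z^k` at `x`. -/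
def curl (A : OneForm n N) (x : N) (u : ℝ) (v : TangentSpace (𝓡 n) x) :
    TangentSpace (𝓡 n) x →L[ℝ] ℝ :=
  let D : EuclideanSpace ℝ (Fin n) →L[ℝ] EuclideanSpace ℝ (Fin n) →L[ℝ] ℝ :=
    fderiv ℝ (localForm A x u) (extChartAt (𝓡 n) x x)
  (D v - D.flip v : EuclideanSpace ℝ (Fin n) →L[ℝ] ℝ)

/-- The covector `A_{k,u} dx^k` at `x`. -/
def formDu (A : OneForm n N) (x : N) (u : ℝ) : TangentSpace (𝓡 n) x →L[ℝ] ℝ :=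
  let A' : ℝ → EuclideanSpace ℝ (Fin n) →L[ℝ] ℝ := fun u' => A x u'
  (deriv A' u : EuclideanSpace ℝ (Fin n) →L[ℝ] ℝ)

/-- The spatial differential `H_{,k} dx^k` at `x` of the function `H(·, u)`. -/
def spatialDiff (H : N × ℝ → ℝ) (x : N) (u : ℝ) : TangentSpace (𝓡 n) x →L[ℝ] ℝ :=
  mfderiv (𝓡 n) 𝓘(ℝ, ℝ) (fun x' => H (x', u)) x

/-- The force
`- h^{ik} (A_{k,j} - A_{j,k}) v^j u' - ½ h^{ik} (2 A_{k,u} - H_{,k}) u'²`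
at `(x, u)` on a particle with velocity `v`; here `du₀` stands for `u'`. -/
def force (h : MetricField (𝓡 n) (M := N)) (H : N × ℝ → ℝ) (A : OneForm n N)
    (du₀ : ℝ) (x : N) (u : ℝ) (v : TangentSpace (𝓡 n) x) : TangentSpace (𝓡 n) x :=
  - (du₀ • (h x).inverse (curl A x u v))
    - (1 / 2 * du₀ ^ 2 : ℝ) • (h x).inverse ((2 : ℝ) • formDu A x u - spatialDiff H x u)

/-- `x` restricted to the open set `J` solves the forced equation of motion
`D_{x'} x'^i = - h^{ik} (A_{k,j} - A_{j,k}) x'^j u₀' - ½ h^{ik} (2 A_{k,u} - H_{,k}) u₀'²`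
on `N`, the right hand side being evaluated at `(x(s), u(s))` with `u(s) = u₀ + s u₀'`. -/
def IsTrajectoryOn (h : MetricField (𝓡 n) (M := N)) (H : N × ℝ → ℝ) (A : OneForm n N)
    (u₀ du₀ : ℝ) (x : ℝ → N) (J : Set ℝ) : Prop :=
  ContMDiffOn 𝓘(ℝ, ℝ) (𝓡 n) 2 x J ∧
    ∀ s ∈ J, covAccel h x s = force h H A du₀ (x s) (u₀ + s * du₀) (velocity (𝓡 n) x s)

end Spacetime

end PPWave

end

/-!
The metric `g = h - 2 du dr + H du² + 2 A du` does not depend on `r`, and its only component along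
`∂_r` is `g(∂_u, ∂_r) = -1`. Testing the geodesic equation against the three kinds of coordinate
directions therefore decouples it, at every parameter value:

* against `∂_r` it says `u'' = 0`, so `u` is affine;
* against a direction `z` tangent to `N` it says, once `u'' = 0`, that `x` solves the forced
  equation of motion, with `u'` in the place of the constant speed;
* against `∂_u` it is the balance law for the momentum `g(γ', ∂_u) = H u' + A(x') - r'`, whose
  derivative has to be `½ g(γ', γ')` with the metric coefficients differentiated in `u`.

This is `covAccel_ppMetric_eq_zero_iff` together with `hasDerivAt_momentum`; everything is computed
in the chart centred at the point under consideration, where the chart identifies the tangent space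
with the model space.

If `u' = b ≠ 0`, the derivative of the energy `g(γ', γ')` is `2 b` times the defect in the third
equation when the first two hold (`hasDerivAt_energy`). Hence constant energy replaces the third
equation, and solving the definition of the energy for `r'` and integrating gives the formula
for `r`.

For completeness, the momentum balance is used for all `b`, zero included. Given a trajectory `x`,
it prescribes `r''` as a continuous function of the parameter, so `x` lifts to a geodesic over the
same interval, with arbitrary `r` and `r'` at one point (`IsTrajectoryOn.exists_isGeodesicOn`), and
the lift is determined by this choice (`IsGeodesicOn.eqOn_null`). A lift of an inextendible
trajectory is inextendible, since an extension of the lift projects to an extension of the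
trajectory. Conversely the projection of an inextendible geodesic extends, by Zorn's lemma, to an
inextendible trajectory; if that one is complete, then its lift extends the geodesic to `ℝ`.
No existence or uniqueness theorem for nonlinear ordinary differential equations is needed.
-/

noncomputable section

namespace PPWave

/-! ### Linear algebra and calculus in normed spaces -/

theorem isInvertible_of_nondegenerate {E : Type*} [NormedAddCommGroup E] [NormedSpace ℝ E]
    [FiniteDimensional ℝ E] {L : E →L[ℝ] E →L[ℝ] ℝ} (hL : ∀ v, (∀ w, L v w = 0) → v = 0) :
    L.IsInvertible := by
  have hinj : Function.Injective L := (injective_iff_map_eq_zero L).2 fun v hv =>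
    hL v fun w => by simp [hv]
  have hdim : Module.finrank ℝ E = Module.finrank ℝ (E →L[ℝ] ℝ) := by
    rw [← (LinearMap.toContinuousLinearMap (𝕜 := ℝ) (E := E) (F' := ℝ)).finrank_eq]
    exact (Subspace.dual_finrank_eq (K := ℝ) (V := E)).symm
  exact ⟨(LinearEquiv.ofInjectiveOfFinrankEq (L : E →ₗ[ℝ] E →L[ℝ] ℝ) hinj
    hdim).toContinuousLinearEquiv, by ext; rfl⟩

/-- Lowering an index: an equation for a vector that involves an inverse metric is equivalent to the
equation of its pairings. -/
theorem add_inverse_eq_iff {E : Type*} [NormedAddCommGroup E] [NormedSpace ℝ E]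
    {L : E →L[ℝ] E →L[ℝ] ℝ} (hL : L.IsInvertible) (a F : E) (φ : E →L[ℝ] ℝ) :
    a + L.inverse φ = F ↔ ∀ z, L a z + φ z = L F z := by
  have hinj : Function.Injective L := by
    obtain ⟨e, he⟩ := hL
    rw [← he]
    exact e.injective
  rw [← hinj.eq_iff, map_add, hL.self_apply_inverse, DFunLike.ext_iff]
  rfl

theorem hasDerivAt_and_hasDerivAt_deriv {F : Type*} [NormedAddCommGroup F] [NormedSpace ℝ F]
    {f : ℝ → F} {t : ℝ} (hf : ContDiffAt ℝ 2 f t) :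
    HasDerivAt f (deriv f t) t ∧ HasDerivAt (deriv f) (deriv (deriv f) t) t := by
  refine ⟨(hf.differentiableAt (by simp)).hasDerivAt, ?_⟩
  have h1 : ContDiffAt ℝ 1 (deriv f) t := (hf.fderiv_right (m := 1) (by norm_num)).clm_apply contDiffAt_const
  exact (h1.differentiableAt (by simp)).hasDerivAt

theorem two_le_infty : (2 : WithTop ℕ∞) ≤ ∞ :=
  WithTop.coe_le_coe.2 (le_top : (2 : ℕ∞) ≤ ⊤)

theorem hasDerivAt_quadratic {V : Type*} [NormedAddCommGroup V] [NormedSpace ℝ V]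
    {g : V → V →L[ℝ] V →L[ℝ] ℝ} {c w : ℝ → V} {t : ℝ} {c' w' : V}
    (hg : DifferentiableAt ℝ g (c t)) (hc : HasDerivAt c c' t) (hw : HasDerivAt w w' t) :
    HasDerivAt (fun s => g (c s) (w s) (w s))
      (fderiv ℝ g (c t) c' (w t) (w t) + g (c t) w' (w t) + g (c t) (w t) w') t := by
  have h1 : HasDerivAt (fun s => g (c s)) (fderiv ℝ g (c t) c') t :=
    HasFDerivAt.comp_hasDerivAt (E := V →L[ℝ] V →L[ℝ] ℝ) t hg.hasFDerivAt hc
  have h2 : HasDerivAt (fun s => g (c s) (w s)) (fderiv ℝ g (c t) c' (w t) + g (c t) w') t :=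
    HasDerivAt.clm_apply (F := V) (G := V →L[ℝ] ℝ) h1 hw
  exact h2.clm_apply hw

theorem hasFDerivAt_apply_apply {V F : Type*} [NormedAddCommGroup V] [NormedSpace ℝ V]
    [NormedAddCommGroup F] [NormedSpace ℝ F] {g : F → V →L[ℝ] V →L[ℝ] ℝ} {y : F}
    (hg : DifferentiableAt ℝ g y) (v w : V) :
    HasFDerivAt (fun q => g q v w) (((fderiv ℝ g y).flip v).flip w) y := by
  have h1 : HasFDerivAt (fun q => g q v) ((fderiv ℝ g y).flip v) y := by
    simpa using hg.hasFDerivAt.clm_apply (hasFDerivAt_const v y)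
  simpa using h1.clm_apply (hasFDerivAt_const w y)

section Calculus

variable {V : Type*} [NormedAddCommGroup V] [NormedSpace ℝ V]
  {G : V × (ℝ × ℝ) → V × (ℝ × ℝ) →L[ℝ] V × (ℝ × ℝ) →L[ℝ] ℝ} {g : V → V →L[ℝ] V →L[ℝ] ℝ}
  {η : V × ℝ → ℝ} {α : V × ℝ → V →L[ℝ] ℝ} {O : Set V}

/-- Differentiability of a field of bilinear forms on `V × ℝ²` of pp-wave type, with coefficients
`g`, `η`, `α` that are smooth over an open set `O`. -/
theorem differentiableAt_ppForm [FiniteDimensional ℝ V] (hO : IsOpen O) (hg : ContDiffOn ℝ ∞ g O)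
    (hη : ContDiffOn ℝ ∞ η (O ×ˢ univ)) (hα : ContDiffOn ℝ ∞ α (O ×ˢ univ))
    (hG : ∀ q, q.1 ∈ O → ∀ v w, G q v w = g q.1 v.1 w.1 - (v.2.1 * w.2.2 + v.2.2 * w.2.1)
      + η (q.1, q.2.1) * (v.2.1 * w.2.1)
      + (v.2.1 * α (q.1, q.2.1) w.1 + α (q.1, q.2.1) v.1 * w.2.1))
    {y : V × (ℝ × ℝ)} (hy : y.1 ∈ O) : DifferentiableAt ℝ G y := by
  have hO' : IsOpen (Prod.fst ⁻¹' O : Set (V × (ℝ × ℝ))) := hO.preimage continuous_fst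
  suffices hs : ContDiffOn ℝ ∞ G (Prod.fst ⁻¹' O) from
    (hs.contDiffAt (hO'.mem_nhds hy)).differentiableAt (by simp)
  refine contDiffOn_clm_apply.2 fun v => contDiffOn_clm_apply.2 fun w => ?_
  refine ContDiffOn.congr ?_ fun q hq => hG q hq v w
  have hf : ContDiffOn ℝ ∞ (fun q : V × (ℝ × ℝ) => q.1) (Prod.fst ⁻¹' O) := contDiffOn_fst
  have hπ : ContDiffOn ℝ ∞ (fun q : V × (ℝ × ℝ) => (q.1, q.2.1)) (Prod.fst ⁻¹' O) :=
    (contDiff_fst.prodMk (contDiff_fst.comp contDiff_snd)).contDiffOn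
  have hm : MapsTo (fun q : V × (ℝ × ℝ) => (q.1, q.2.1)) (Prod.fst ⁻¹' O) (O ×ˢ univ) :=
    fun q hq => ⟨hq, mem_univ _⟩
  have h0 : ContDiffOn ℝ ∞ (fun q : V × (ℝ × ℝ) => g q.1 v.1 w.1) (Prod.fst ⁻¹' O) :=
    ((hg.comp hf fun q hq => hq).clm_apply contDiffOn_const).clm_apply contDiffOn_const
  have h1 : ContDiffOn ℝ ∞ (fun q : V × (ℝ × ℝ) => η (q.1, q.2.1)) (Prod.fst ⁻¹' O) :=
    hη.comp hπ hm
  have h2 : ∀ z, ContDiffOn ℝ ∞ (fun q : V × (ℝ × ℝ) => α (q.1, q.2.1) z) (Prod.fst ⁻¹' O) :=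
    fun z => (hα.comp hπ hm).clm_apply contDiffOn_const
  exact ((h0.sub contDiffOn_const).add (h1.mul contDiffOn_const)).add
    ((contDiffOn_const.mul (h2 _)).add ((h2 _).mul contDiffOn_const))

/-- The derivative of a field of bilinear forms of pp-wave type comes from the derivatives of its
coefficients, because the mixed component `-2 du dr` is constant. -/
theorem fderiv_ppForm [FiniteDimensional ℝ V] (hO : IsOpen O) (hg : ContDiffOn ℝ ∞ g O)
    (hη : ContDiffOn ℝ ∞ η (O ×ˢ univ)) (hα : ContDiffOn ℝ ∞ α (O ×ˢ univ))
    (hG : ∀ q, q.1 ∈ O → ∀ v w, G q v w = g q.1 v.1 w.1 - (v.2.1 * w.2.2 + v.2.2 * w.2.1)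
      + η (q.1, q.2.1) * (v.2.1 * w.2.1)
      + (v.2.1 * α (q.1, q.2.1) w.1 + α (q.1, q.2.1) v.1 * w.2.1))
    {y : V × (ℝ × ℝ)} (hy : y.1 ∈ O) (Z v w : V × (ℝ × ℝ)) :
    fderiv ℝ G y Z v w = fderiv ℝ g y.1 Z.1 v.1 w.1
      + fderiv ℝ η (y.1, y.2.1) (Z.1, Z.2.1) * (v.2.1 * w.2.1)
      + (v.2.1 * fderiv ℝ α (y.1, y.2.1) (Z.1, Z.2.1) w.1
        + fderiv ℝ α (y.1, y.2.1) (Z.1, Z.2.1) v.1 * w.2.1) := by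
  have hev : (fun q => G q v w) =ᶠ[nhds y] fun q =>
      g q.1 v.1 w.1 - (v.2.1 * w.2.2 + v.2.2 * w.2.1) + η (q.1, q.2.1) * (v.2.1 * w.2.1)
      + (v.2.1 * α (q.1, q.2.1) w.1 + α (q.1, q.2.1) v.1 * w.2.1) := by
    filter_upwards [(hO.preimage continuous_fst).mem_nhds hy] with q hq using hG q hq v w
  have hmem : O ×ˢ univ ∈ nhds (y.1, y.2.1) :=
    (hO.prod isOpen_univ).mem_nhds ⟨hy, mem_univ _⟩
  have hπ : HasFDerivAt (fun q : V × (ℝ × ℝ) => (q.1, q.2.1))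
      ((ContinuousLinearMap.fst ℝ _ _).prod
        ((ContinuousLinearMap.fst ℝ ℝ ℝ).comp (ContinuousLinearMap.snd ℝ _ _))) y :=
    hasFDerivAt_fst.prodMk ((hasFDerivAt_fst (p := y.2)).comp y hasFDerivAt_snd)
  have h0 : HasFDerivAt (fun q : V × (ℝ × ℝ) => g q.1 v.1 w.1) _ y :=
    HasFDerivAt.comp (g := fun x => g x v.1 w.1) y (hasFDerivAt_apply_apply
      ((hg.contDiffAt (hO.mem_nhds hy)).differentiableAt (by simp)) v.1 w.1) hasFDerivAt_fst
  have h1 := ((hη.contDiffAt hmem).differentiableAt (by simp)).hasFDerivAt.comp y hπ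
  have h2 := fun z => (((hα.contDiffAt hmem).differentiableAt (by simp)).hasFDerivAt.comp y
    hπ).clm_apply (hasFDerivAt_const z y)
  have hsum := (((h0.sub_const (v.2.1 * w.2.2 + v.2.2 * w.2.1)).add
    (h1.mul_const (v.2.1 * w.2.1))).add
    (((h2 w.1).const_mul v.2.1).add ((h2 v.1).mul_const w.2.1))).congr_of_eventuallyEq hev
  have hdG := hasFDerivAt_apply_apply (differentiableAt_ppForm hO hg hη hα hG hy) v w
  have := DFunLike.congr_fun (hdG.unique hsum) Z
  simp at this
  rw [this]
  ring

end Calculus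

/-! ### Functions of one real variable on an open interval -/

theorem exists_hasDerivAt_of_continuousOn {J : Set ℝ} (hJ : IsOpenInterval J) {f : ℝ → ℝ}
    (hf : ContinuousOn f J) {s₀ : ℝ} (hs₀ : s₀ ∈ J) (a : ℝ) :
    ∃ F : ℝ → ℝ, F s₀ = a ∧ ∀ s ∈ J, HasDerivAt F (f s) s := by
  refine ⟨fun s => a + ∫ σ in s₀..s, f σ, by simp, fun s hs => ?_⟩
  refine HasDerivAt.const_add _ (intervalIntegral.integral_hasDerivAt_right ?_ ?_ ?_)
  · exact (hf.mono (hJ.2.1.uIcc_subset hs₀ hs)).intervalIntegrable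
  · exact hf.stronglyMeasurableAtFilter hJ.1 s hs
  · exact hf.continuousAt (hJ.1.mem_nhds hs)

theorem eqOn_of_hasDerivAt {J : Set ℝ} (hJ : IsOpenInterval J) {f g f' : ℝ → ℝ}
    (hf : ∀ s ∈ J, HasDerivAt f (f' s) s) (hg : ∀ s ∈ J, HasDerivAt g (f' s) s)
    {s₀ : ℝ} (hs₀ : s₀ ∈ J) (h : f s₀ = g s₀) : EqOn f g J :=
  hJ.1.eqOn_of_deriv_eq hJ.2.1.isPreconnected
    (fun s hs => (hf s hs).differentiableAt.differentiableWithinAt)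
    (fun s hs => (hg s hs).differentiableAt.differentiableWithinAt)
    (fun s hs => (hf s hs).deriv.trans (hg s hs).deriv.symm) hs₀ h

theorem contDiffOn_two_of_hasDerivAt {J : Set ℝ} (hJ : IsOpen J) {f f' : ℝ → ℝ}
    (hf : ∀ s ∈ J, HasDerivAt f (f' s) s) (hf' : ContDiffOn ℝ 1 f' J) : ContDiffOn ℝ 2 f J := by
  have : (2 : WithTop ℕ∞) = 1 + 1 := by norm_num
  rw [this, contDiffOn_succ_iff_deriv_of_isOpen hJ]
  exact ⟨fun s hs => (hf s hs).differentiableAt.differentiableWithinAt, by simp,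
    hf'.congr fun s hs => (hf s hs).deriv⟩

/-- A function `r` for which `m - r'` has the prescribed derivative `f`, with prescribed value and
derivative of `r` at one point. -/
theorem exists_contDiffOn_two {J : Set ℝ} (hJ : IsOpenInterval J) {m f : ℝ → ℝ}
    (hm : ContDiffOn ℝ 1 m J) (hf : ContinuousOn f J) {s₀ : ℝ} (hs₀ : s₀ ∈ J) (r₀ r₁ : ℝ) :
    ∃ r : ℝ → ℝ, r s₀ = r₀ ∧ deriv r s₀ = r₁ ∧ ContDiffOn ℝ 2 r J ∧
      ∀ s ∈ J, HasDerivAt (fun s => m s - deriv r s) (f s) s := by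
  obtain ⟨F, hF₀, hF⟩ := exists_hasDerivAt_of_continuousOn hJ hf hs₀ (m s₀ - r₁)
  have hF1 : ContDiffOn ℝ 1 F J := by
    have : (1 : WithTop ℕ∞) = 0 + 1 := by norm_num
    rw [this, contDiffOn_succ_iff_deriv_of_isOpen hJ.1]
    exact ⟨fun s hs => (hF s hs).differentiableAt.differentiableWithinAt, by simp,
      contDiffOn_zero.2 (hf.congr fun s hs => (hF s hs).deriv)⟩
  obtain ⟨r, hr₀, hr⟩ := exists_hasDerivAt_of_continuousOn hJ
    (hm.continuousOn.sub hF1.continuousOn) hs₀ r₀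
  refine ⟨r, hr₀, ?_, contDiffOn_two_of_hasDerivAt hJ.1 hr (hm.sub hF1), fun s hs => ?_⟩
  · rw [(hr s₀ hs₀).deriv]
    simp [hF₀]
  · refine (hF s hs).congr_of_eventuallyEq ?_
    filter_upwards [hJ.1.mem_nhds hs] with σ hσ
    rw [(hr σ hσ).deriv]
    simp

theorem eqOn_affine {J : Set ℝ} (hJ : IsOpenInterval J) {u : ℝ → ℝ} (hu : ContDiffOn ℝ 2 u J)
    (hu₂ : ∀ s ∈ J, deriv (deriv u) s = 0) : ∃ u₀ b, ∀ s ∈ J, u s = u₀ + s * b := by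
  obtain ⟨s₀, hs₀⟩ := hJ.2.2
  have h1 : ContDiffOn ℝ 1 (deriv u) J := by
    have : (2 : WithTop ℕ∞) = 1 + 1 := by norm_num
    rw [this, contDiffOn_succ_iff_deriv_of_isOpen hJ.1] at hu
    exact hu.2.2
  have h2 : EqOn (deriv u) (fun _ => deriv u s₀) J := by
    refine eqOn_of_hasDerivAt hJ (f' := fun _ => 0) (fun s hs => ?_)
      (fun s _ => hasDerivAt_const s _) hs₀ rfl
    rw [← hu₂ s hs]
    exact ((h1.differentiableOn (by simp)).differentiableAt (hJ.1.mem_nhds hs)).hasDerivAt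
  refine ⟨u s₀ - s₀ * deriv u s₀, deriv u s₀, ?_⟩
  refine eqOn_of_hasDerivAt hJ (f' := fun _ => deriv u s₀) (fun s hs => ?_)
      (fun s _ => ?_) hs₀ (by ring)
  · rw [← show deriv u s = deriv u s₀ from h2 hs]
    exact ((hu.differentiableOn (by simp)).differentiableAt (hJ.1.mem_nhds hs)).hasDerivAt
  · simpa using ((hasDerivAt_id s).mul_const (deriv u s₀)).const_add (u s₀ - s₀ * deriv u s₀)

theorem exists_ne_of_isOpenInterval {J : Set ℝ} (hJ : IsOpenInterval J) {s₀ : ℝ} (hs₀ : s₀ ∈ J) :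
    ∃ s ∈ J, s ≠ s₀ := by
  obtain ⟨ε, hε, h⟩ := Metric.isOpen_iff.1 hJ.1 s₀ hs₀
  exact ⟨s₀ + ε / 2, h (by simp [abs_of_pos hε, hε]), by simp [hε.ne']⟩

theorem deriv_of_eqOn_affine {J : Set ℝ} (hJ : IsOpen J) {u : ℝ → ℝ} {u₀ b : ℝ}
    (hu : ∀ s ∈ J, u s = u₀ + s * b) {s : ℝ} (hs : s ∈ J) :
    u =ᶠ[nhds s] (fun s => u₀ + s * b) ∧ deriv u =ᶠ[nhds s] (fun _ => b) := by
  have h0 : u =ᶠ[nhds s] (fun s => u₀ + s * b) :=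
    Filter.eventuallyEq_of_mem (hJ.mem_nhds hs) hu
  refine ⟨h0, h0.deriv.trans (Filter.Eventually.of_forall fun σ => ?_)⟩
  simp

theorem affine_unique {J : Set ℝ} (hJ : IsOpenInterval J) {u₀ b u₁ b₁ : ℝ}
    (heq : ∀ s ∈ J, u₀ + s * b = u₁ + s * b₁) : u₀ = u₁ ∧ b = b₁ := by
  obtain ⟨s₀, hs₀⟩ := hJ.2.2
  obtain ⟨s, hs, hne⟩ := exists_ne_of_isOpenInterval hJ hs₀
  have h1 := heq s₀ hs₀
  have h2 := heq s hs
  have h3 : b = b₁ := by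
    have : (s - s₀) * (b - b₁) = 0 := by linear_combination h2 - h1
    rcases mul_eq_zero.1 this with h | h
    · exact absurd (sub_eq_zero.1 h) hne
    · exact sub_eq_zero.1 h
  subst h3
  exact ⟨by linarith, rfl⟩

/-! ### Extending a solution to an inextendible one -/

/-- A solution of a problem that is local in the parameter extends to an inextendible solution, by
Zorn's lemma: the solutions in a chain agree where they are defined, hence have a common extension. -/
theorem exists_inextendible_extension {X : Type*} {P : (ℝ → X) → Set ℝ → Prop}
    {Q : (ℝ → X) → ℝ → Prop} (hPQ : ∀ c J, IsOpen J → (P c J ↔ ∀ s ∈ J, Q c s))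
    (hQ : ∀ c c' s, c =ᶠ[nhds s] c' → Q c s → Q c' s) {c : ℝ → X} {J : Set ℝ}
    (hJ : IsOpenInterval J) (hc : P c J) :
    ∃ c' J', J ⊆ J' ∧ EqOn c c' J ∧ IsInextendible P c' J' := by
  classical
  let α := {p : (ℝ → X) × Set ℝ // IsOpenInterval p.2 ∧ P p.1 p.2 ∧ J ⊆ p.2 ∧ EqOn c p.1 J}
  let R : α → α → Prop := fun a b => a.1.2 ⊆ b.1.2 ∧ EqOn a.1.1 b.1.1 a.1.2
  have hRefl : ∀ a, R a a := fun a => ⟨subset_rfl, fun _ _ => rfl⟩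
  have : Nonempty α := ⟨⟨(c, J), hJ, hc, subset_rfl, fun _ _ => rfl⟩⟩
  have hub : ∀ C, IsChain R C → C.Nonempty → ∃ ub, ∀ a ∈ C, R a ub := by
    intro C hC hne
    have htot : ∀ a ∈ C, ∀ b ∈ C, R a b ∨ R b a := fun a ha b hb => by
      by_cases hab : a = b
      · exact hab ▸ Or.inl (hRefl a)
      · exact hC ha hb hab
    -- The upper bound: the union of the domains, with the values of any member of the chain.
    let U : Set ℝ := ⋃ a ∈ C, a.1.2
    let f : ℝ → X := fun s => if hs : ∃ a ∈ C, s ∈ a.1.2 then hs.choose.1.1 s else c s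
    have hf : ∀ a ∈ C, EqOn a.1.1 f a.1.2 := fun a ha s hs => by
      have hex : ∃ a ∈ C, s ∈ a.1.2 := ⟨a, ha, hs⟩
      have hf' : f s = hex.choose.1.1 s := dif_pos hex
      rw [hf']
      rcases htot a ha _ hex.choose_spec.1 with hr | hr
      · exact hr.2 hs
      · exact (hr.2 hex.choose_spec.2).symm
    have hUopen : IsOpen U := isOpen_biUnion fun a _ => a.2.1.1
    have hsubU : ∀ a ∈ C, a.1.2 ⊆ U := fun a ha => subset_biUnion_of_mem (u := fun a : α => a.1.2) ha
    obtain ⟨a₀, ha₀⟩ := hne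
    have hU : IsOpenInterval U := by
      refine ⟨hUopen, ⟨fun s hs s' hs' => ?_⟩, a₀.2.1.2.2.mono (hsubU a₀ ha₀)⟩
      obtain ⟨a, ha, hsa⟩ := mem_iUnion₂.1 hs
      obtain ⟨b, hb, hsb⟩ := mem_iUnion₂.1 hs'
      rcases htot a ha b hb with hr | hr
      · exact (b.2.1.2.1.out (hr.1 hsa) hsb).trans (hsubU b hb)
      · exact (a.2.1.2.1.out hsa (hr.1 hsb)).trans (hsubU a ha)
    refine ⟨⟨(f, U), hU, (hPQ _ _ hUopen).2 fun s hs => ?_, a₀.2.2.2.1.trans (hsubU a₀ ha₀),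
      fun s hs => (a₀.2.2.2.2 hs).trans (hf a₀ ha₀ (a₀.2.2.2.1 hs))⟩,
      fun a ha => ⟨hsubU a ha, hf a ha⟩⟩
    obtain ⟨a, ha, hsa⟩ := mem_iUnion₂.1 hs
    exact hQ _ _ s ((hf a ha).eventuallyEq_of_mem (a.2.1.1.mem_nhds hsa))
      ((hPQ _ _ a.2.1.1).1 a.2.2.1 s hsa)
  obtain ⟨m, hm⟩ := exists_maximal_of_nonempty_chains_bounded (r := R) hub
    (fun hab hbc => ⟨hab.1.trans hbc.1, fun s hs => (hab.2 hs).trans (hbc.2 (hab.1 hs))⟩)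
  refine ⟨m.1.1, m.1.2, m.2.2.2.1, m.2.2.2.2, m.2.1, m.2.2.1, fun c' J' hJ' hsub hP heq => ?_⟩
  exact (hm ⟨(c', J'), hJ', hP, m.2.2.2.1.trans hsub, fun s hs =>
      (m.2.2.2.2 hs).trans (heq (m.2.2.2.1 hs))⟩ ⟨hsub, heq⟩).1.antisymm hsub

/-! ### Frames and velocities in a chart -/

section ChartFrame

variable {E : Type*} [NormedAddCommGroup E] [NormedSpace ℝ E]
  {B : Type*} [TopologicalSpace B] {I : ModelWithCorners ℝ E B}
  {M : Type*} [TopologicalSpace M] [ChartedSpace B M]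

/-- The coordinate basis map of a chart is the inverse of the corresponding trivialization of the tangent
bundle. This gives its smoothness and its value at the centre of the chart. -/
theorem chartFrame_eq_symmL [IsManifold I 1 M] (p : M) {y : E} (hy : y ∈ (extChartAt I p).target) (v : E) :
    chartFrame I p y v =
      (trivializationAt E (TangentSpace I) p).symmL ℝ ((extChartAt I p).symm y) v := by
  have hx : (extChartAt I p).symm y ∈ (chartAt B p).source := by
    simpa using (extChartAt I p).map_target hy
  rw [TangentBundle.symmL_trivializationAt hx]
  rw [chartFrame]
  rw [(extChartAt I p).right_inv hy]

/-- At the centre of the chart the coordinate basis map is the identity, since the tangent space is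
identified with the model space through this very chart. -/
theorem chartFrame_self [IsManifold I 1 M] (p : M) (v : E) :
    (chartFrame I p (extChartAt I p p) v : E) = v := by
  rw [chartFrame_eq_symmL p (mem_extChartAt_target p)]
  rw [extChartAt_to_inv, TangentBundle.symmL_trivializationAt_eq_core (mem_chart_source _ _)]
  exact (tangentBundleCore I M).coordChange_self (achart B p) p (mem_chart_source B p) v

theorem contMDiffOn_chartFrame [I.Boundaryless] [IsManifold I ∞ M] (p : M) (v : E) :
    ContMDiffOn 𝓘(ℝ, E) (I.prod 𝓘(ℝ, E)) ∞ (fun y : E => TotalSpace.mk' E (E := TangentSpace I (M := M))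
      ((extChartAt I p).symm y) (chartFrame I p y v)) (extChartAt I p).target := by
  have : IsManifold I 1 M := .of_le (n := ∞) (by simp)
  have h := (trivializationAt E (TangentSpace I (M := M)) p).contMDiffOn_symm (IB := I) (n := ∞)
  have h2 : ContMDiffOn 𝓘(ℝ, E) (I.prod 𝓘(ℝ, E)) ∞ (fun y : E => ((extChartAt I p).symm y, v))
    (extChartAt I p).target := (contMDiffOn_extChartAt_symm p).prodMk contMDiffOn_const
  refine (h.comp h2 ?_).congr ?_
  · intro y hy
    have := (extChartAt I p).map_target hy
    simpa [(trivializationAt E (TangentSpace I (M := M)) p).mem_target] using this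
  · intro y hy
    have hx : (extChartAt I p).symm y ∈ (chartAt B p).source := by
      simpa using (extChartAt I p).map_target hy
    simp only [Function.comp]
    rw [chartFrame_eq_symmL p hy]
    rw [← (trivializationAt E (TangentSpace I (M := M)) p).mk_symm (by simpa using hx),
      Trivialization.symmL_apply _ (by simpa using hx)]

/-- The velocity at a point near the centre of a chart is the coordinate velocity, read through the
coordinate basis map. -/
theorem velocity_eq_chartFrame [IsManifold I 1 M] [I.Boundaryless] {p : M} {γ : ℝ → M} {s : ℝ}
   (hγ : MDifferentiableAt 𝓘(ℝ, ℝ) I γ s) (hs : γ s ∈ (extChartAt I p).source) :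
   (velocity I γ s : E) = (chartFrame I p (extChartAt I p (γ s)) (deriv (fun s => extChartAt I p (γ s)) s) : E) := by
  have hd : MDifferentiableAt I 𝓘(ℝ, E) (extChartAt I p) (γ s) :=
    mdifferentiableAt_extChartAt (by simpa using hs)
  have h1 : deriv (fun s => extChartAt I p (γ s)) s =
      mfderiv I 𝓘(ℝ, E) (extChartAt I p) (γ s) (velocity I γ s) := by
    have := mfderiv_comp s hd hγ
    rw [mfderiv_eq_fderiv] at this
    rw [← fderiv_apply_one_eq_deriv]
    exact DFunLike.congr_fun this (1 : ℝ)
  rw [h1]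
  exact (DFunLike.congr_fun (mfderivWithin_extChartAt_symm_comp_mfderiv_extChartAt' hs)
    (velocity I γ s)).symm

/-- The components of a smooth metric are smooth in a chart: they are values of the metric on coordinate
vector fields, which are smooth sections. -/
theorem contDiffOn_localMetric [I.Boundaryless] [IsManifold I ∞ M] [FiniteDimensional ℝ E]
    {g : MetricField I (M := M)}
    (hg : ContMDiff I (I.prod 𝓘(ℝ, E →L[ℝ] E →L[ℝ] ℝ)) ∞
      (fun p => TotalSpace.mk' (E →L[ℝ] E →L[ℝ] ℝ) p (g p))) (p : M) :
    ContDiffOn ℝ ∞ (localMetric g p) (extChartAt I p).target := by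
  refine contDiffOn_clm_apply.2 fun v => contDiffOn_clm_apply.2 fun w => ?_
  rw [← contMDiffOn_iff_contDiffOn]
  intro y hy
  have h1 := (hg.comp_contMDiffOn (contMDiffOn_extChartAt_symm p)) y hy
  have h2 : ContMDiffWithinAt 𝓘(ℝ, E) (I.prod 𝓘(ℝ)) ∞
      (fun y ↦ TotalSpace.mk' ℝ (E := Bundle.Trivial M ℝ) ((extChartAt I p).symm y)
        (g ((extChartAt I p).symm y) (chartFrame I p y v) (chartFrame I p y w)))
        (extChartAt I p).target y :=
    ContMDiffWithinAt.clm_bundle_apply₂ (F₁ := E) (F₂ := E) h1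
      (contMDiffOn_chartFrame p v y hy) (contMDiffOn_chartFrame p w y hy)
  rw [contMDiffWithinAt_totalSpace] at h2
  exact h2.2

end ChartFrame

section Form

variable {n : ℕ} {N : Type*} [TopologicalSpace N] [ChartedSpace (EuclideanSpace ℝ (Fin n)) N]
  [IsManifold (𝓡 n) ∞ N]

theorem contDiffOn_localForm {A : OneForm n N} (hA : A.IsSmooth) (p : N) :
    ContDiffOn ℝ ∞ (fun q : EuclideanSpace ℝ (Fin n) × ℝ => localForm A p q.2 q.1)
      ((extChartAt (𝓡 n) p).target ×ˢ univ) := by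
  refine contDiffOn_clm_apply.2 fun v => ?_
  rw [← contMDiffOn_iff_contDiffOn, modelWithCornersSelf_prod, ← chartedSpaceSelf_prod]
  have hf : ContMDiffOn (𝓘(ℝ, EuclideanSpace ℝ (Fin n)).prod 𝓘(ℝ, ℝ))
      𝓘(ℝ, EuclideanSpace ℝ (Fin n)) ∞ (fun q : EuclideanSpace ℝ (Fin n) × ℝ => q.1)
      ((extChartAt (𝓡 n) p).target ×ˢ univ) := contMDiffOn_fst
  have hm : MapsTo (fun q : EuclideanSpace ℝ (Fin n) × ℝ => q.1)
      ((extChartAt (𝓡 n) p).target ×ˢ univ) (extChartAt (𝓡 n) p).target := fun q hq => hq.1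
  intro y hy
  have h1 := (hA.comp_contMDiffOn
    (((contMDiffOn_extChartAt_symm p).comp hf hm).prodMk contMDiffOn_snd)) y hy
  have h2 : ContMDiffWithinAt (𝓘(ℝ, EuclideanSpace ℝ (Fin n)).prod 𝓘(ℝ, ℝ)) ((𝓡 n).prod 𝓘(ℝ)) ∞
      (fun q : EuclideanSpace ℝ (Fin n) × ℝ ↦ TotalSpace.mk' ℝ (E := Bundle.Trivial N ℝ)
        ((extChartAt (𝓡 n) p).symm q.1)
        (A ((extChartAt (𝓡 n) p).symm q.1) q.2 (chartFrame (𝓡 n) p q.1 v)))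
        ((extChartAt (𝓡 n) p).target ×ˢ univ) y :=
    ContMDiffWithinAt.clm_bundle_apply (F₁ := EuclideanSpace ℝ (Fin n)) h1
      (((contMDiffOn_chartFrame p v).comp hf hm) y hy)
  rw [contMDiffWithinAt_totalSpace] at h2
  exact h2.2

theorem contDiffOn_localFunction {H : N × ℝ → ℝ}
    (hH : ContMDiff ((𝓡 n).prod 𝓘(ℝ, ℝ)) 𝓘(ℝ, ℝ) ∞ H) (p : N) :
    ContDiffOn ℝ ∞ (fun q : EuclideanSpace ℝ (Fin n) × ℝ => H ((extChartAt (𝓡 n) p).symm q.1, q.2))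
      ((extChartAt (𝓡 n) p).target ×ˢ univ) := by
  have hf : ContMDiffOn (𝓘(ℝ, EuclideanSpace ℝ (Fin n)).prod 𝓘(ℝ, ℝ))
      𝓘(ℝ, EuclideanSpace ℝ (Fin n)) ∞ (fun q : EuclideanSpace ℝ (Fin n) × ℝ => q.1)
      ((extChartAt (𝓡 n) p).target ×ˢ univ) := contMDiffOn_fst
  have h1 := hH.comp_contMDiffOn
    (((contMDiffOn_extChartAt_symm p).comp hf fun q hq => hq.1).prodMk contMDiffOn_snd)
  rw [← contMDiffOn_iff_contDiffOn, modelWithCornersSelf_prod, ← chartedSpaceSelf_prod]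
  exact h1

end Form

/-! ### The covariant acceleration in components, and the pp-wave metric in a chart -/

section Geometry

variable {E : Type*} [NormedAddCommGroup E] [NormedSpace ℝ E]
  {B : Type*} [TopologicalSpace B] {I : ModelWithCorners ℝ E B}
  {M : Type*} [TopologicalSpace M] [ChartedSpace B M]

theorem christoffelFirst_self_apply (g : MetricField I (M := M)) (p : M) (y v z : E) :
    christoffelFirst g p y v v z = fderiv ℝ (localMetric g p) y v v z
      - 1 / 2 * fderiv ℝ (localMetric g p) y z v v := by
  simp [christoffelFirst]
  ring

theorem localMetric_apply (g : MetricField I (M := M)) (p : M) (y v w : E) :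
    localMetric g p y v w = g ((extChartAt I p).symm y) (chartFrame I p y v) (chartFrame I p y w) :=
  rfl

theorem localMetric_self [IsManifold I 1 M] (g : MetricField I (M := M)) (p : M) (v w : E) :
    localMetric g p (extChartAt I p p) v w = g p v w := by
  -- The tangent spaces at equal points are different types, so the equality of points is
  -- eliminated once, in a statement over the model space.
  have key : ∀ q, q = p → ∀ v w : E, g q v w = g p v w := by rintro q rfl v w; rfl
  rw [localMetric_apply]
  refine (key _ (extChartAt_to_inv p) _ _).trans ?_
  congr 1
  · congr 1
    exact chartFrame_self p v
  · exact chartFrame_self p w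

/-- The equation `D_{γ'} γ' = F` in the chart at `γ t`, with the index lowered. -/
theorem covAccel_eq_iff {g : MetricField I (M := M)} {γ : ℝ → M} {t : ℝ}
    (hg : (localMetric g (γ t) (extChartAt I (γ t) (γ t))).IsInvertible)
    (F : TangentSpace I (γ t)) :
    covAccel g γ t = F ↔ ∀ z : E,
      localMetric g (γ t) (extChartAt I (γ t) (γ t))
          (deriv (deriv fun s => extChartAt I (γ t) (γ s)) t) z +
        christoffelFirst g (γ t) (extChartAt I (γ t) (γ t))
          (deriv (fun s => extChartAt I (γ t) (γ s)) t)
          (deriv (fun s => extChartAt I (γ t) (γ s)) t) z =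
      localMetric g (γ t) (extChartAt I (γ t) (γ t)) F z := by
  exact add_inverse_eq_iff hg _ _ _

end Geometry

section Spacetime

variable {n : ℕ} {N : Type*} [TopologicalSpace N] [ChartedSpace (EuclideanSpace ℝ (Fin n)) N]

theorem extChartAt_spacetime_symm (p : N × (ℝ × ℝ)) (y : EuclideanSpace ℝ (Fin n) × (ℝ × ℝ)) :
    (extChartAt (spacetimeModel n) p).symm y = ((extChartAt (𝓡 n) p.1).symm y.1, y.2) := by
  rfl

theorem chartFrame_spacetime [IsManifold (𝓡 n) ∞ N] (p : N × (ℝ × ℝ))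
    {y : EuclideanSpace ℝ (Fin n) × (ℝ × ℝ)} (hy : y.1 ∈ (extChartAt (𝓡 n) p.1).target)
    (v : EuclideanSpace ℝ (Fin n) × (ℝ × ℝ)) :
    (chartFrame (spacetimeModel n) p y v : EuclideanSpace ℝ (Fin n) × (ℝ × ℝ)) =
      (chartFrame (𝓡 n) p.1 y.1 v.1, v.2) := by
  have hx : HasMFDerivAt 𝓘(ℝ, EuclideanSpace ℝ (Fin n) × (ℝ × ℝ)) (𝓡 n)
      (fun q : EuclideanSpace ℝ (Fin n) × (ℝ × ℝ) => (extChartAt (𝓡 n) p.1).symm q.1) y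
      ((chartFrame (𝓡 n) p.1 y.1).comp (ContinuousLinearMap.fst ℝ _ _)) := by
    have h1 : HasMFDerivAt 𝓘(ℝ, EuclideanSpace ℝ (Fin n)) (𝓡 n) (extChartAt (𝓡 n) p.1).symm y.1
        (chartFrame (𝓡 n) p.1 y.1) := by
      have : IsManifold (𝓡 n) 1 N := .of_le (n := ∞) (by simp)
      exact (mdifferentiableWithinAt_extChartAt_symm hy).hasMFDerivWithinAt.hasMFDerivAt (by simp)
    exact h1.comp y (hasFDerivAt_fst (p := y)).hasMFDerivAt
  have hu : HasMFDerivAt 𝓘(ℝ, EuclideanSpace ℝ (Fin n) × (ℝ × ℝ)) 𝓘(ℝ, ℝ)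
      (fun q : EuclideanSpace ℝ (Fin n) × (ℝ × ℝ) => q.2.1) y
      ((ContinuousLinearMap.fst ℝ ℝ ℝ).comp (ContinuousLinearMap.snd ℝ _ _)) :=
    ((hasFDerivAt_fst (p := y.2)).comp y hasFDerivAt_snd).hasMFDerivAt
  have hr : HasMFDerivAt 𝓘(ℝ, EuclideanSpace ℝ (Fin n) × (ℝ × ℝ)) 𝓘(ℝ, ℝ)
      (fun q : EuclideanSpace ℝ (Fin n) × (ℝ × ℝ) => q.2.2) y
      ((ContinuousLinearMap.snd ℝ ℝ ℝ).comp (ContinuousLinearMap.snd ℝ _ _)) :=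
    ((hasFDerivAt_snd (p := y.2)).comp y hasFDerivAt_snd).hasMFDerivAt
  have hall := hx.prodMk (hu.prodMk hr)
  rw [chartFrame, ModelWithCorners.range_eq_univ, mfderivWithin_univ]
  have key : mfderiv 𝓘(ℝ, EuclideanSpace ℝ (Fin n) × (ℝ × ℝ)) (spacetimeModel n)
      (extChartAt (spacetimeModel n) p).symm y = _ := hall.mfderiv
  rw [key]
  rfl

theorem localForm_self [IsManifold (𝓡 n) ∞ N] (A : OneForm n N) (p : N) (u : ℝ)
    (v : EuclideanSpace ℝ (Fin n)) :
    localForm A p u (extChartAt (𝓡 n) p p) v = A p u v := by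
  have : IsManifold (𝓡 n) 1 N := .of_le (n := ∞) (by simp)
  -- The equality of points is eliminated in a statement over the model space, as for the metric.
  have key : ∀ q, q = p → ∀ v : EuclideanSpace ℝ (Fin n), A q u v = A p u v := by
    rintro q rfl v; rfl
  refine (key _ (extChartAt_to_inv p) _).trans ?_
  congr 1
  exact chartFrame_self p v

theorem localMetric_ppMetric [IsManifold (𝓡 n) ∞ N] (h : MetricField (𝓡 n) (M := N))
    (H : N × ℝ → ℝ) (A : OneForm n N) (p : N × (ℝ × ℝ))
    {y : EuclideanSpace ℝ (Fin n) × (ℝ × ℝ)} (hy : y.1 ∈ (extChartAt (𝓡 n) p.1).target)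
    (v w : EuclideanSpace ℝ (Fin n) × (ℝ × ℝ)) :
    localMetric (ppMetric h H A) p y v w = localMetric h p.1 y.1 v.1 w.1
      - (v.2.1 * w.2.2 + v.2.2 * w.2.1)
      + H ((extChartAt (𝓡 n) p.1).symm y.1, y.2.1) * (v.2.1 * w.2.1)
      + (v.2.1 * localForm A p.1 y.2.1 y.1 w.1 + localForm A p.1 y.2.1 y.1 v.1 * w.2.1) := by
  rw [localMetric_apply]
  have key : ∀ q, q = ((extChartAt (𝓡 n) p.1).symm y.1, y.2) →
    ∀ v w : EuclideanSpace ℝ (Fin n) × (ℝ × ℝ), ppMetric h H A q v w =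
      ppMetric h H A ((extChartAt (𝓡 n) p.1).symm y.1, y.2) v w := by
    rintro q rfl v w; rfl
  refine (key _ (extChartAt_spacetime_symm p y) _ _).trans ?_
  rw [chartFrame_spacetime p hy v, chartFrame_spacetime p hy w]
  exact ppMetric_apply h H A _ _ _ _ _ _ _ _ _

theorem velocity_spacetime {x : ℝ → N} {u r : ℝ → ℝ} {s : ℝ}
    (hx : MDifferentiableAt 𝓘(ℝ, ℝ) (𝓡 n) x s) (hu : DifferentiableAt ℝ u s)
    (hr : DifferentiableAt ℝ r s) :
    (velocity (spacetimeModel n) (fun s => (x s, (u s, r s))) s :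
      EuclideanSpace ℝ (Fin n) × (ℝ × ℝ)) = (velocity (𝓡 n) x s, (deriv u s, deriv r s)) := by
  have h := (hx.hasMFDerivAt.prodMk (hu.hasFDerivAt.hasMFDerivAt.prodMk
    hr.hasFDerivAt.hasMFDerivAt)).mfderiv
  rw [velocity, h]
  rfl

end Spacetime

/-! ### The geodesic equation split along the factors of the product -/

section

variable {n : ℕ} {N : Type*} [TopologicalSpace N] [ChartedSpace (EuclideanSpace ℝ (Fin n)) N]

/-- The function `H` in the chart of `N` at `p`, as a function of the coordinate point and of `u`. -/
def localFunction (H : N × ℝ → ℝ) (p : N) (q : EuclideanSpace ℝ (Fin n) × ℝ) : ℝ :=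
  H ((extChartAt (𝓡 n) p).symm q.1, q.2)

/-- The components of the one-form `A` in the chart of `N` at `p`, as a function of the coordinate point
and of `u` jointly. -/
def localFormJoint (A : OneForm n N) (p : N) (q : EuclideanSpace ℝ (Fin n) × ℝ) :
    EuclideanSpace ℝ (Fin n) →L[ℝ] ℝ :=
  localForm A p q.2 q.1

/-- The defect in the equation of motion, tested against `z`, in the chart of `N` at `p`. The arguments
`y`, `v`, `a` are the position, velocity and acceleration in coordinates, and `b` is the speed
of `u`. The derivative of the one-form along `(v, b)` collects `A_{k,j} v^j` and `A_{k,u} b`. -/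
def spatialDefect (h : MetricField (𝓡 n) (M := N)) (H : N × ℝ → ℝ) (A : OneForm n N) (p : N)
    (y v a : EuclideanSpace ℝ (Fin n)) (u b : ℝ) (z : EuclideanSpace ℝ (Fin n)) : ℝ :=
  localMetric h p y a z + christoffelFirst h p y v v z
    + b * (fderiv ℝ (localFormJoint A p) (y, u) (v, b) z
      - fderiv ℝ (localFormJoint A p) (y, u) (z, 0) v)
    - 1 / 2 * b ^ 2 * fderiv ℝ (localFunction H p) (y, u) (z, 0)

/-- The defect in the geodesic equation of the pp-wave metric tested against `∂_u`, in the chart of `N`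
at `p`. The arguments `y`, `v`, `a` are the position, velocity and acceleration of the component in `N`,
the numbers `b`, `u₂` are the first and second derivatives of `u`, and `r₂` is the second derivative
of `r`. -/
def nullDefect (H : N × ℝ → ℝ) (A : OneForm n N) (p : N)
    (y v a : EuclideanSpace ℝ (Fin n)) (u b u₂ r₂ : ℝ) : ℝ :=
  localFunction H p (y, u) * u₂ + localFormJoint A p (y, u) a - r₂
    + fderiv ℝ (localFunction H p) (y, u) (v, b) * b
    + fderiv ℝ (localFormJoint A p) (y, u) (v, b) v
    - (1 / 2 * b ^ 2 * fderiv ℝ (localFunction H p) (y, u) (0, 1)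
      + b * fderiv ℝ (localFormJoint A p) (y, u) (0, 1) v)

variable [IsManifold (𝓡 n) ∞ N]
  (h : ContMDiffRiemannianMetric (𝓡 n) ∞ (EuclideanSpace ℝ (Fin n))
    (fun x : N => TangentSpace (𝓡 n) x))
  {H : N × ℝ → ℝ} (hH : ContMDiff ((𝓡 n).prod 𝓘(ℝ, ℝ)) 𝓘(ℝ, ℝ) ∞ H)
  {A : OneForm n N} (hA : A.IsSmooth)

theorem localMetric_symm (p : N) (y v w : EuclideanSpace ℝ (Fin n)) :
    localMetric h.inner p y v w = localMetric h.inner p y w v := by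
  rw [localMetric_apply, localMetric_apply]
  exact h.symm _ _ _

theorem isInvertible_localMetric (p : N) :
    (localMetric h.inner p (extChartAt (𝓡 n) p p)).IsInvertible := by
  have : IsManifold (𝓡 n) 1 N := .of_le (n := ∞) (by simp)
  refine isInvertible_of_nondegenerate fun v hv => ?_
  by_contra hne
  have h1 := h.pos p v hne
  have h2 := localMetric_self (I := 𝓡 n) h.inner p v v
  rw [hv v] at h2
  exact h1.ne h2

/-- The pp-wave metric is nondegenerate: pairing with `∂_r`, then with `N`, then with `∂_u` recovers the
components of a vector one after the other. -/
theorem isInvertible_localMetric_ppMetric (H : N × ℝ → ℝ) (A : OneForm n N) (p : N × (ℝ × ℝ)) :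
    (localMetric (ppMetric h.inner H A) p
      (extChartAt (spacetimeModel n) p p)).IsInvertible := by
  refine isInvertible_of_nondegenerate fun v hv => ?_
  have hmem : (extChartAt (spacetimeModel n) p p).1 ∈ (extChartAt (𝓡 n) p.1).target :=
    mem_extChartAt_target p.1
  simp only [localMetric_ppMetric h.inner H A p hmem] at hv
  have hu : v.2.1 = 0 := by simpa using hv (0, (0, 1))
  have hx : v.1 = 0 := by
    obtain ⟨e, he⟩ := isInvertible_localMetric h p.1
    apply e.injective
    rw [map_zero]
    ext z
    have := hv (z, (0, 0))
    simp only [hu] at this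
    have he' := DFunLike.congr_fun (DFunLike.congr_fun he v.1) z
    refine he'.trans ?_
    simpa using this
  have hr : v.2.2 = 0 := by simpa [hu, hx] using hv (0, (1, 0))
  exact Prod.ext hx (Prod.ext hu hr)

theorem differentiableAt_localMetric (p : N) {y : EuclideanSpace ℝ (Fin n)}
    (hy : y ∈ (extChartAt (𝓡 n) p).target) : DifferentiableAt ℝ (localMetric h.inner p) y :=
  ((contDiffOn_localMetric h.contMDiff p).contDiffAt
    ((isOpen_extChartAt_target p).mem_nhds hy)).differentiableAt (by simp)

include hH in
theorem contDiffAt_localFunction (p : N) {y : EuclideanSpace ℝ (Fin n)}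
    (hy : y ∈ (extChartAt (𝓡 n) p).target) (u : ℝ) :
    ContDiffAt ℝ ∞ (localFunction H p) (y, u) :=
  (contDiffOn_localFunction hH p).contDiffAt
    (((isOpen_extChartAt_target p).prod isOpen_univ).mem_nhds ⟨hy, mem_univ _⟩)

include hA in
theorem contDiffAt_localFormJoint (p : N) {y : EuclideanSpace ℝ (Fin n)}
    (hy : y ∈ (extChartAt (𝓡 n) p).target) (u : ℝ) :
    ContDiffAt ℝ ∞ (localFormJoint A p) (y, u) :=
  (contDiffOn_localForm hA p).contDiffAt
    (((isOpen_extChartAt_target p).prod isOpen_univ).mem_nhds ⟨hy, mem_univ _⟩)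

include hA hH in
theorem fderiv_localMetric_ppMetric (p : N × (ℝ × ℝ))
    {y : EuclideanSpace ℝ (Fin n) × (ℝ × ℝ)} (hy : y.1 ∈ (extChartAt (𝓡 n) p.1).target)
    (Z v w : EuclideanSpace ℝ (Fin n) × (ℝ × ℝ)) :
    fderiv ℝ (localMetric (ppMetric h.inner H A) p) y Z v w =
      fderiv ℝ (localMetric h.inner p.1) y.1 Z.1 v.1 w.1
      + fderiv ℝ (localFunction H p.1) (y.1, y.2.1) (Z.1, Z.2.1) * (v.2.1 * w.2.1)
      + (v.2.1 * fderiv ℝ (localFormJoint A p.1) (y.1, y.2.1) (Z.1, Z.2.1) w.1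
        + fderiv ℝ (localFormJoint A p.1) (y.1, y.2.1) (Z.1, Z.2.1) v.1 * w.2.1) := by
  exact fderiv_ppForm (isOpen_extChartAt_target p.1) (contDiffOn_localMetric h.contMDiff p.1)
    (contDiffOn_localFunction hH p.1) (contDiffOn_localForm hA p.1)
    (fun q hq v w => localMetric_ppMetric h.inner H A p hq v w) hy Z v w

end

/-! ### Curves in a chart and the equation of motion on the base -/

section

variable {n : ℕ} {N : Type*} [TopologicalSpace N] [ChartedSpace (EuclideanSpace ℝ (Fin n)) N]
  [IsManifold (𝓡 n) ∞ N]
  (h : ContMDiffRiemannianMetric (𝓡 n) ∞ (EuclideanSpace ℝ (Fin n))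
    (fun x : N => TangentSpace (𝓡 n) x))
  {H : N × ℝ → ℝ} (hH : ContMDiff ((𝓡 n).prod 𝓘(ℝ, ℝ)) 𝓘(ℝ, ℝ) ∞ H)
  {A : OneForm n N} (hA : A.IsSmooth)

variable (n) in
/-- The coordinate expression of the curve `x` in the chart of `N` at `x t`. -/
def coordCurve (x : ℝ → N) (t : ℝ) (s : ℝ) : EuclideanSpace ℝ (Fin n) :=
  extChartAt (𝓡 n) (x t) (x s)

section Curve

variable {x : ℝ → N} {u r : ℝ → ℝ} {t : ℝ}

theorem contDiffAt_coordCurve (hx : ContMDiffAt 𝓘(ℝ, ℝ) (𝓡 n) 2 x t) :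
    ContDiffAt ℝ 2 (coordCurve n x t) t := by
  rw [← contMDiffAt_iff_contDiffAt]
  exact ((contMDiffAt_extChartAt (n := ∞)).of_le two_le_infty).comp t hx

theorem eventually_velocity_eq_chartFrame (hx : ContMDiffAt 𝓘(ℝ, ℝ) (𝓡 n) 2 x t) :
    ∀ᶠ s in nhds t, x s ∈ (extChartAt (𝓡 n) (x t)).source ∧
      (velocity (𝓡 n) x s : EuclideanSpace ℝ (Fin n)) =
        (chartFrame (𝓡 n) (x t) (coordCurve n x t s) (deriv (coordCurve n x t) s) :
          EuclideanSpace ℝ (Fin n)) := by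
  have : IsManifold (𝓡 n) 1 N := .of_le (n := ∞) (by simp)
  have : IsManifold (𝓡 n) 2 N := .of_le (n := ∞) two_le_infty
  have h1 : ∀ᶠ s in nhds t, ContMDiffAt 𝓘(ℝ, ℝ) (𝓡 n) 2 x s :=
    (contMDiffAt_iff_contMDiffAt_nhds (I := 𝓘(ℝ, ℝ)) (I' := 𝓡 n) (n := 2) (by simp)).1 hx
  filter_upwards [h1, hx.continuousAt.preimage_mem_nhds (extChartAt_source_mem_nhds (I := 𝓡 n) (x t))]
    with s hs hs'
  exact ⟨hs', velocity_eq_chartFrame (hs.mdifferentiableAt (by simp)) hs'⟩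

theorem localForm_along (hx : ContMDiffAt 𝓘(ℝ, ℝ) (𝓡 n) 2 x t) (u : ℝ → ℝ) :
    (fun s => A (x s) (u s) (velocity (𝓡 n) x s)) =ᶠ[nhds t] fun s =>
      localFormJoint A (x t) (coordCurve n x t s, u s) (deriv (coordCurve n x t) s) := by
  filter_upwards [eventually_velocity_eq_chartFrame hx] with s hs
  have key : ∀ q, x s = q → ∀ v : EuclideanSpace ℝ (Fin n), A (x s) (u s) v = A q (u s) v := by
    rintro q rfl v; rfl
  refine (key _ ((extChartAt (𝓡 n) (x t)).left_inv hs.1).symm _).trans ?_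
  rw [hs.2]
  rfl

theorem localFunction_along (hx : ContMDiffAt 𝓘(ℝ, ℝ) (𝓡 n) 2 x t) (u : ℝ → ℝ) :
    (fun s => H (x s, u s)) =ᶠ[nhds t] fun s =>
      localFunction H (x t) (coordCurve n x t s, u s) := by
  filter_upwards [eventually_velocity_eq_chartFrame hx] with s hs
  rw [localFunction, coordCurve, (extChartAt (𝓡 n) (x t)).left_inv hs.1]

theorem localMetric_along (g : MetricField (𝓡 n) (M := N)) (hx : ContMDiffAt 𝓘(ℝ, ℝ) (𝓡 n) 2 x t) :
    (fun s => g (x s) (velocity (𝓡 n) x s) (velocity (𝓡 n) x s)) =ᶠ[nhds t] fun s =>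
      localMetric g (x t) (coordCurve n x t s) (deriv (coordCurve n x t) s)
        (deriv (coordCurve n x t) s) := by
  filter_upwards [eventually_velocity_eq_chartFrame hx] with s hs
  have key : ∀ q, x s = q → ∀ v w : EuclideanSpace ℝ (Fin n), g (x s) v w = g q v w := by
    rintro q rfl v w; rfl
  refine (key _ ((extChartAt (𝓡 n) (x t)).left_inv hs.1).symm _ _).trans ?_
  rw [localMetric_apply, hs.2]
  rfl

omit [IsManifold (𝓡 n) ∞ N] in
theorem coordCurve_mem_target (x : ℝ → N) (t : ℝ) :
    coordCurve n x t t ∈ (extChartAt (𝓡 n) (x t)).target :=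
  mem_extChartAt_target (x t)

include hH in
theorem hasDerivAt_function_along (hx : ContMDiffAt 𝓘(ℝ, ℝ) (𝓡 n) 2 x t)
    (hu : ContDiffAt ℝ 2 u t) :
    HasDerivAt (fun s => H (x s, u s)) (fderiv ℝ (localFunction H (x t)) (coordCurve n x t t, u t)
      (deriv (coordCurve n x t) t, deriv u t)) t := by
  have hc := (hasDerivAt_and_hasDerivAt_deriv (contDiffAt_coordCurve hx)).1
  have h1 := ((contDiffAt_localFunction hH (x t) (coordCurve_mem_target (n := n) x t)
    (u t)).differentiableAt (by simp)).hasFDerivAt.comp_hasDerivAt t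
      (f := fun s => (coordCurve n x t s, u s))
      (hc.prodMk (hasDerivAt_and_hasDerivAt_deriv hu).1)
  exact h1.congr_of_eventuallyEq (localFunction_along hx u)

include hA in
theorem hasDerivAt_form_along (hx : ContMDiffAt 𝓘(ℝ, ℝ) (𝓡 n) 2 x t)
    (hu : ContDiffAt ℝ 2 u t) :
    HasDerivAt (fun s => A (x s) (u s) (velocity (𝓡 n) x s))
      (fderiv ℝ (localFormJoint A (x t)) (coordCurve n x t t, u t)
        (deriv (coordCurve n x t) t, deriv u t) (deriv (coordCurve n x t) t)
      + localFormJoint A (x t) (coordCurve n x t t, u t) (deriv (deriv (coordCurve n x t)) t)) t := by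
  have hc := (hasDerivAt_and_hasDerivAt_deriv (contDiffAt_coordCurve hx))
  have h1 := ((contDiffAt_localFormJoint hA (x t) (coordCurve_mem_target (n := n) x t)
    (u t)).differentiableAt (by simp)).hasFDerivAt.comp_hasDerivAt t
      (f := fun s => (coordCurve n x t s, u s))
      (hc.1.prodMk (hasDerivAt_and_hasDerivAt_deriv hu).1)
  exact (h1.clm_apply hc.2).congr_of_eventuallyEq (localForm_along hx u)

theorem hasDerivAt_metric_along (hx : ContMDiffAt 𝓘(ℝ, ℝ) (𝓡 n) 2 x t) :
    HasDerivAt (fun s => h.inner (x s) (velocity (𝓡 n) x s) (velocity (𝓡 n) x s))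
      (2 * (localMetric h.inner (x t) (coordCurve n x t t) (deriv (deriv (coordCurve n x t)) t)
          (deriv (coordCurve n x t) t)
        + christoffelFirst h.inner (x t) (coordCurve n x t t) (deriv (coordCurve n x t) t)
          (deriv (coordCurve n x t) t) (deriv (coordCurve n x t) t))) t := by
  have hc := (hasDerivAt_and_hasDerivAt_deriv (contDiffAt_coordCurve hx))
  refine ((hasDerivAt_quadratic (differentiableAt_localMetric h (x t)
    (coordCurve_mem_target x t)) hc.1 hc.2).congr_of_eventuallyEq
    (localMetric_along h.inner hx)).congr_deriv ?_
  rw [christoffelFirst_self_apply]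
  rw [localMetric_symm h (x t) _ (deriv (coordCurve n x t) t)]
  ring

include hA in
theorem fderiv_localForm_fixed (p : N) (u : ℝ) (v : EuclideanSpace ℝ (Fin n)) :
    fderiv ℝ (localForm A p u) (extChartAt (𝓡 n) p p) v =
      fderiv ℝ (localFormJoint A p) (extChartAt (𝓡 n) p p, u) (v, 0) := by
  have h1 := ((contDiffAt_localFormJoint hA p (mem_extChartAt_target p)
    u).differentiableAt (by simp)).hasFDerivAt.comp (extChartAt (𝓡 n) p p)
      (f := fun y => (y, u)) (hasFDerivAt_prodMk_left _ _)
  have h2 : fderiv ℝ (localForm A p u) (extChartAt (𝓡 n) p p) = _ := h1.fderiv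
  rw [h2]
  rfl

include hA in
theorem formDu_apply (p : N) (u : ℝ) (z : EuclideanSpace ℝ (Fin n)) :
    formDu A p u z = fderiv ℝ (localFormJoint A p) (extChartAt (𝓡 n) p p, u) (0, 1) z := by
  have h1 := ((contDiffAt_localFormJoint hA p (mem_extChartAt_target p)
    u).differentiableAt (by simp)).hasFDerivAt.comp_hasDerivAt u
      (f := fun u' => (extChartAt (𝓡 n) p p, u')) ((hasDerivAt_const u _).prodMk (hasDerivAt_id u))
  have h2 : @Eq (ℝ → EuclideanSpace ℝ (Fin n) →L[ℝ] ℝ) (fun u' => A p u')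
      (localFormJoint A p ∘ fun u' => (extChartAt (𝓡 n) p p, u')) := by
    funext u'
    ext v
    exact (localForm_self A p u' v).symm
  rw [← h2] at h1
  exact DFunLike.congr_fun h1.deriv z

include hH in
theorem spatialDiff_apply (p : N) (u : ℝ) (z : EuclideanSpace ℝ (Fin n)) :
    spatialDiff H p u z = fderiv ℝ (localFunction H p) (extChartAt (𝓡 n) p p, u) (z, 0) := by
  have h1 := ((contDiffAt_localFunction hH p (mem_extChartAt_target p)
    u).differentiableAt (by simp)).hasFDerivAt.comp (extChartAt (𝓡 n) p p)
      (f := fun y => (y, u)) (hasFDerivAt_prodMk_left _ _)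
  have hd : MDifferentiableAt (𝓡 n) 𝓘(ℝ, ℝ) (fun x' => H (x', u)) p :=
    (hH.comp (contMDiff_id.prodMk contMDiff_const)).mdifferentiableAt (by simp)
  have h2 : mfderiv (𝓡 n) 𝓘(ℝ, ℝ) (fun x' => H (x', u)) p =
      fderiv ℝ (localFunction H p ∘ fun y => (y, u)) (extChartAt (𝓡 n) p p) := by
    rw [hd.mfderiv, ModelWithCorners.range_eq_univ, fderivWithin_univ]
    rfl
  rw [h1.fderiv] at h2
  exact DFunLike.congr_fun h2 z

/-- Nondegeneracy of the Riemannian metric, so that its `ContinuousLinearMap.inverse` is a true inverse. -/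
theorem inner_inverse_apply (p : N) (φ : TangentSpace (𝓡 n) p →L[ℝ] ℝ) :
    h.inner p ((h.inner p).inverse φ) = φ := by
  let L : EuclideanSpace ℝ (Fin n) →L[ℝ] EuclideanSpace ℝ (Fin n) →L[ℝ] ℝ := h.inner p
  have h1 : L.IsInvertible := by
    refine isInvertible_of_nondegenerate fun v hv => ?_
    by_contra hne
    exact (h.pos p v hne).ne (hv v).symm
  exact h1.self_apply_inverse φ

theorem inner_force (p : N) (b u : ℝ) (v z : TangentSpace (𝓡 n) p) :
    h.inner p (force h.inner H A b p u v) z =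
      - (b * curl A p u v z) - 1 / 2 * b ^ 2 * (2 * formDu A p u z - spatialDiff H p u z) := by
  rw [force]
  simp only [map_sub, map_neg, map_smul, inner_inverse_apply]
  simp

include hH hA in
/-- The equation of motion on `N` at one parameter value, in the chart at `x t`. -/
theorem covAccel_eq_force_iff (x : ℝ → N) (t b u : ℝ)
    (hx : ContMDiffAt 𝓘(ℝ, ℝ) (𝓡 n) 2 x t) :
    covAccel h.inner x t = force h.inner H A b (x t) u (velocity (𝓡 n) x t) ↔
      ∀ z, spatialDefect h.inner H A (x t) (coordCurve n x t t) (deriv (coordCurve n x t) t)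
        (deriv (deriv (coordCurve n x t)) t) u b z = 0 := by
  have : IsManifold (𝓡 n) 1 N := .of_le (n := ∞) (by simp)
  have hv : (velocity (𝓡 n) x t : EuclideanSpace ℝ (Fin n)) = deriv (coordCurve n x t) t :=
    (eventually_velocity_eq_chartFrame hx).self_of_nhds.2.trans (chartFrame_self (x t) _)
  rw [covAccel_eq_iff (isInvertible_localMetric h (x t))]
  refine forall_congr' fun z => ?_
  have hF : localMetric h.inner (x t) (extChartAt (𝓡 n) (x t) (x t))
      (force h.inner H A b (x t) u (velocity (𝓡 n) x t)) z =
      - (b * (fderiv ℝ (localFormJoint A (x t)) (coordCurve n x t t, u)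
          (deriv (coordCurve n x t) t, 0) z
        - fderiv ℝ (localFormJoint A (x t)) (coordCurve n x t t, u) (z, 0)
          (deriv (coordCurve n x t) t)))
      - 1 / 2 * b ^ 2 * (2 * fderiv ℝ (localFormJoint A (x t)) (coordCurve n x t t, u) (0, 1) z
        - fderiv ℝ (localFunction H (x t)) (coordCurve n x t t, u) (z, 0)) := by
    refine (localMetric_self h.inner (x t) _ z).trans ((inner_force h (x t) b u _ z).trans ?_)
    rw [formDu_apply hA, spatialDiff_apply hH]
    have hc : curl A (x t) u (velocity (𝓡 n) x t) z =
      fderiv ℝ (localForm A (x t) u) (extChartAt (𝓡 n) (x t) (x t)) (velocity (𝓡 n) x t) z -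
      fderiv ℝ (localForm A (x t) u) (extChartAt (𝓡 n) (x t) (x t)) z (velocity (𝓡 n) x t) := rfl
    rw [hc, hv, fderiv_localForm_fixed hA, fderiv_localForm_fixed hA]
    rfl
  rw [hF]
  have hsplit : fderiv ℝ (localFormJoint A (x t)) (coordCurve n x t t, u)
      (deriv (coordCurve n x t) t, b) =
      fderiv ℝ (localFormJoint A (x t)) (coordCurve n x t t, u) (deriv (coordCurve n x t) t, 0) +
      b • fderiv ℝ (localFormJoint A (x t)) (coordCurve n x t t, u) (0, 1) := by
    rw [← map_smul, ← map_add]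
    simp
  rw [spatialDefect, hsplit]
  simp only [add_apply, smul_apply, smul_eq_mul]
  rw [← sub_eq_zero]
  refine Eq.congr ?_ rfl
  change localMetric h.inner (x t) (coordCurve n x t t) (deriv (deriv (coordCurve n x t)) t) z +
    christoffelFirst h.inner (x t) (coordCurve n x t t) (deriv (coordCurve n x t) t)
      (deriv (coordCurve n x t) t) z - _ = _
  ring

end Curve

end

/-! ### Geodesics, momentum and energy in the pp-wave -/

section

variable {n : ℕ} {N : Type*} [TopologicalSpace N] [ChartedSpace (EuclideanSpace ℝ (Fin n)) N]
  [IsManifold (𝓡 n) ∞ N]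
  (h : ContMDiffRiemannianMetric (𝓡 n) ∞ (EuclideanSpace ℝ (Fin n))
    (fun x : N => TangentSpace (𝓡 n) x))
  {H : N × ℝ → ℝ} (hH : ContMDiff ((𝓡 n).prod 𝓘(ℝ, ℝ)) 𝓘(ℝ, ℝ) ∞ H)
  {A : OneForm n N} (hA : A.IsSmooth)

section Curve

variable {x : ℝ → N} {u r : ℝ → ℝ} {t : ℝ}

theorem deriv_coord_spacetime (hx : ContMDiffAt 𝓘(ℝ, ℝ) (𝓡 n) 2 x t)
    (hu : ContDiffAt ℝ 2 u t) (hr : ContDiffAt ℝ 2 r t) :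
    deriv (fun s => (coordCurve n x t s, (u s, r s))) t =
      (deriv (coordCurve n x t) t, (deriv u t, deriv r t)) ∧
    deriv (deriv (fun s => (coordCurve n x t s, (u s, r s)))) t =
      (deriv (deriv (coordCurve n x t)) t, (deriv (deriv u) t, deriv (deriv r) t)) := by
  have hc := contDiffAt_coordCurve hx
  have hev : deriv (fun s => (coordCurve n x t s, (u s, r s))) =ᶠ[nhds t]
      fun s => (deriv (coordCurve n x t) s, (deriv u s, deriv r s)) := by
    filter_upwards [hc.eventually (by simp), hu.eventually (by simp), hr.eventually (by simp)]
      with s h1 h2 h3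
    exact ((hasDerivAt_and_hasDerivAt_deriv h1).1.prodMk ((hasDerivAt_and_hasDerivAt_deriv h2).1.prodMk
      (hasDerivAt_and_hasDerivAt_deriv h3).1)).deriv
  refine ⟨hev.self_of_nhds, ?_⟩
  rw [hev.deriv_eq]
  exact ((hasDerivAt_and_hasDerivAt_deriv hc).2.prodMk ((hasDerivAt_and_hasDerivAt_deriv hu).2.prodMk
      (hasDerivAt_and_hasDerivAt_deriv hr).2)).deriv

include hH hA in
/-- The left-hand side of the geodesic equation of the pp-wave metric, tested against `Z = (z, ζ, ρ)`, for
position `y`, velocity `v` and acceleration `a` in the product chart. The component `ρ` meets only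
the second derivative of `u`. -/
theorem localMetric_add_christoffelFirst_ppMetric (p : N × (ℝ × ℝ))
    {y : EuclideanSpace ℝ (Fin n) × (ℝ × ℝ)} (hy : y.1 ∈ (extChartAt (𝓡 n) p.1).target)
    (a v Z : EuclideanSpace ℝ (Fin n) × (ℝ × ℝ)) :
    localMetric (ppMetric h.inner H A) p y a Z
      + christoffelFirst (ppMetric h.inner H A) p y v v Z =
    spatialDefect h.inner H A p.1 y.1 v.1 a.1 y.2.1 v.2.1 Z.1
      + a.2.1 * (localFormJoint A p.1 (y.1, y.2.1) Z.1 - Z.2.2)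
      + Z.2.1 * nullDefect H A p.1 y.1 v.1 a.1 y.2.1 v.2.1 a.2.1 a.2.2 := by
  have hsplit : ((Z.1, Z.2.1) : EuclideanSpace ℝ (Fin n) × ℝ) =
      (Z.1, 0) + Z.2.1 • ((0, 1) : EuclideanSpace ℝ (Fin n) × ℝ) := by simp
  rw [christoffelFirst_self_apply, fderiv_localMetric_ppMetric h hH hA p hy,
    fderiv_localMetric_ppMetric h hH hA p hy, localMetric_ppMetric h.inner H A p hy,
    spatialDefect, nullDefect, christoffelFirst_self_apply, hsplit, map_add, map_add,
    map_smul, map_smul]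
  simp only [add_apply, smul_apply, smul_eq_mul]
  change _ - _ + localFunction H p.1 (y.1, y.2.1) * _ +
    (_ * localFormJoint A p.1 (y.1, y.2.1) _ + localFormJoint A p.1 (y.1, y.2.1) _ * _) + _ = _
  ring

include hH hA in
/-- The geodesic equation of the pp-wave metric at one parameter value splits into the equations tested
against `∂_r`, the tangent space of `N`, and `∂_u`. -/
theorem covAccel_ppMetric_eq_zero_iff (hx : ContMDiffAt 𝓘(ℝ, ℝ) (𝓡 n) 2 x t)
    (hu : ContDiffAt ℝ 2 u t) (hr : ContDiffAt ℝ 2 r t) :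
    covAccel (ppMetric h.inner H A) (fun s => (x s, (u s, r s))) t = 0 ↔
      deriv (deriv u) t = 0 ∧
      covAccel h.inner x t = force h.inner H A (deriv u t) (x t) (u t) (velocity (𝓡 n) x t) ∧
      nullDefect H A (x t) (coordCurve n x t t) (deriv (coordCurve n x t) t)
        (deriv (deriv (coordCurve n x t)) t) (u t) (deriv u t) (deriv (deriv u) t)
        (deriv (deriv r) t) = 0 := by
  rw [covAccel_eq_force_iff h hH hA x t _ _ hx]
  refine (covAccel_eq_iff (I := spacetimeModel n) (g := ppMetric h.inner H A)
    (γ := fun s => (x s, (u s, r s))) (t := t)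
    (isInvertible_localMetric_ppMetric h H A (x t, (u t, r t))) 0).trans ?_
  have hcoord : (fun s => extChartAt (spacetimeModel n) (x t, (u t, r t)) (x s, (u s, r s))) =
      fun s => (coordCurve n x t s, (u s, r s)) := rfl
  have hd := deriv_coord_spacetime hx hu hr
  simp only [hcoord, hd.1, hd.2]
  have key : ∀ Z : EuclideanSpace ℝ (Fin n) × (ℝ × ℝ), _ := fun Z =>
    localMetric_add_christoffelFirst_ppMetric h hH hA (x t, (u t, r t))
      (y := (coordCurve n x t t, (u t, r t))) (coordCurve_mem_target x t)
      (deriv (deriv (coordCurve n x t)) t, (deriv (deriv u) t, deriv (deriv r) t))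
      (deriv (coordCurve n x t) t, (deriv u t, deriv r t)) Z
  have hz : ∀ Z : EuclideanSpace ℝ (Fin n) × (ℝ × ℝ),
      localMetric (ppMetric h.inner H A) (x t, (u t, r t))
        (extChartAt (spacetimeModel n) (x t, (u t, r t)) (x t, (u t, r t))) 0 Z = 0 := by
    intro Z; simp
  constructor
  · intro hall
    have hall' := fun Z => (key Z).symm.trans ((hall Z).trans (hz Z))
    have h0 : ∀ b u₁, spatialDefect h.inner H A (x t) (coordCurve n x t t)
        (deriv (coordCurve n x t) t) (deriv (deriv (coordCurve n x t)) t) u₁ b 0 = 0 := by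
      intro b u₁
      have : ((0, 0) : EuclideanSpace ℝ (Fin n) × ℝ) = 0 := rfl
      simp [spatialDefect, this]
    -- Test against `∂_r`, then against the tangent space of `N`, then against `∂_u`.
    have h1 : deriv (deriv u) t = 0 := by simpa [h0] using hall' (0, (0, 1))
    refine ⟨h1, fun z => ?_, ?_⟩
    · simpa [h1] using hall' (z, (0, 0))
    · simpa [h0, h1] using hall' (0, (1, 0))
  · rintro ⟨h1, h2, h3⟩ Z
    refine (key Z).trans (Eq.trans ?_ (hz Z).symm)
    simp only [h2, h3]
    simp [h1]

/-- The rate of change of the momentum `g(γ', ∂_u)` along a geodesic: `½ b² ∂_u H + b (∂_u A)(v)` at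
`(x, u)`, where `v` is the velocity in `N` and `b` the speed of `u`. -/
def nullForce (H : N × ℝ → ℝ) (A : OneForm n N) (b : ℝ) (x : N) (u : ℝ)
    (v : TangentSpace (𝓡 n) x) : ℝ :=
  1 / 2 * b ^ 2 * deriv (fun u' => H (x, u')) u + b * formDu A x u v

include hH in
theorem deriv_localFunction (p : N) {y : EuclideanSpace ℝ (Fin n)}
    (hy : y ∈ (extChartAt (𝓡 n) p).target) (u : ℝ) :
    deriv (fun u' => localFunction H p (y, u')) u = fderiv ℝ (localFunction H p) (y, u) (0, 1) :=
  (((contDiffAt_localFunction hH p hy u).differentiableAt (by simp)).hasFDerivAt.comp_hasDerivAt u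
    (f := fun u' => (y, u')) ((hasDerivAt_const u _).prodMk (hasDerivAt_id u))).deriv

include hA in
theorem hasDerivAt_localFormJoint (p : N) {y : EuclideanSpace ℝ (Fin n)}
    (hy : y ∈ (extChartAt (𝓡 n) p).target) (u : ℝ) (v : EuclideanSpace ℝ (Fin n)) :
    HasDerivAt (fun u' => localFormJoint A p (y, u') v)
      (fderiv ℝ (localFormJoint A p) (y, u) (0, 1) v) u := by
  have h1 := ((contDiffAt_localFormJoint hA p hy u).differentiableAt
    (by simp)).hasFDerivAt.comp_hasDerivAt u
    (f := fun u' => (y, u')) ((hasDerivAt_const u _).prodMk (hasDerivAt_id u))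
  simpa using h1.clm_apply (hasDerivAt_const u v)

include hA in
/-- The covector `A_{k,u} dx^k` can be evaluated before differentiating in `u`. -/
theorem formDu_eq_deriv (p : N) (u : ℝ) (v : TangentSpace (𝓡 n) p) :
    formDu A p u v = deriv (fun u' => A p u' v) u := by
  refine (formDu_apply hA p u v).trans ?_
  rw [← (hasDerivAt_localFormJoint hA p (mem_extChartAt_target p) u v).deriv]
  congr 1
  funext u'
  exact localForm_self A p u' v

include hH hA in
/-- The force on the momentum in a fixed chart, for all parameter values near `t`. At a parameter `s ≠ t`
this uses that the partial derivative in `u` commutes with the change of chart. -/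
theorem nullForce_along (hx : ContMDiffAt 𝓘(ℝ, ℝ) (𝓡 n) 2 x t) (u b : ℝ → ℝ) :
    (fun s => nullForce H A (b s) (x s) (u s) (velocity (𝓡 n) x s)) =ᶠ[nhds t] fun s =>
      1 / 2 * b s ^ 2 * fderiv ℝ (localFunction H (x t)) (coordCurve n x t s, u s) (0, 1)
      + b s * fderiv ℝ (localFormJoint A (x t)) (coordCurve n x t s, u s) (0, 1)
        (deriv (coordCurve n x t) s) := by
  filter_upwards [eventually_velocity_eq_chartFrame hx] with s hs
  have hy : coordCurve n x t s ∈ (extChartAt (𝓡 n) (x t)).target :=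
    (extChartAt (𝓡 n) (x t)).map_source hs.1
  have hq : (extChartAt (𝓡 n) (x t)).symm (coordCurve n x t s) = x s :=
    (extChartAt (𝓡 n) (x t)).left_inv hs.1
  have key : ∀ q, x s = q → ∀ (u : ℝ) (v : EuclideanSpace ℝ (Fin n)), A (x s) u v = A q u v := by
    rintro q rfl u v; rfl
  rw [nullForce, formDu_eq_deriv hA, ← deriv_localFunction hH (x t) hy,
    ← (hasDerivAt_localFormJoint hA (x t) hy (u s) _).deriv]
  congr 2
  · congr 1
    funext u'
    rw [localFunction, hq]
  · congr 1
    funext u'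
    refine (key _ hq.symm u' _).trans ?_
    rw [hs.2]
    rfl

include hH hA in
/-- The momentum `g(γ', ∂_u)` changes at the rate `nullForce` plus the defect in the geodesic equation
tested against `∂_u`; along a geodesic that defect vanishes. -/
theorem hasDerivAt_momentum (hx : ContMDiffAt 𝓘(ℝ, ℝ) (𝓡 n) 2 x t)
    (hu : ContDiffAt ℝ 2 u t) (hr : ContDiffAt ℝ 2 r t) :
    HasDerivAt (fun s => H (x s, u s) * deriv u s + A (x s) (u s) (velocity (𝓡 n) x s) - deriv r s)
      (nullDefect H A (x t) (coordCurve n x t t) (deriv (coordCurve n x t) t)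
        (deriv (deriv (coordCurve n x t)) t) (u t) (deriv u t) (deriv (deriv u) t)
        (deriv (deriv r) t)
        + nullForce H A (deriv u t) (x t) (u t) (velocity (𝓡 n) x t)) t := by
  have hHt : H (x t, u t) = localFunction H (x t) (coordCurve n x t t, u t) :=
    (localFunction_along hx u).self_of_nhds
  have hF := (nullForce_along hH hA hx u (deriv u)).self_of_nhds
  beta_reduce at hF
  refine ((((hasDerivAt_function_along hH hx hu).mul (hasDerivAt_and_hasDerivAt_deriv hu).2).add
    (hasDerivAt_form_along hA hx hu)).sub (hasDerivAt_and_hasDerivAt_deriv hr).2).congr_deriv ?_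
  rw [hF, hHt, nullDefect]
  ring

include hH hA in
theorem contDiffAt_momentum (hx : ContMDiffAt 𝓘(ℝ, ℝ) (𝓡 n) 2 x t)
    (hu : ContDiffAt ℝ 2 u t) (b : ℝ) :
    ContDiffAt ℝ 1 (fun s => H (x s, u s) * b + A (x s) (u s) (velocity (𝓡 n) x s)) t := by
  have hc := contDiffAt_coordCurve hx
  have hc' : ContDiffAt ℝ 1 (deriv (coordCurve n x t)) t :=
    (hc.fderiv_right (m := 1) (by norm_num)).clm_apply contDiffAt_const
  have hp : ContDiffAt ℝ 1 (fun s => (coordCurve n x t s, u s)) t :=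
    (hc.prodMk hu).of_le (by norm_num)
  have h1 : ContDiffAt ℝ 1 (fun s => H (x s, u s)) t :=
    (((contDiffAt_localFunction hH (x t) (coordCurve_mem_target x t) (u t)).of_le
      (by simp)).comp t hp).congr_of_eventuallyEq (localFunction_along hx u)
  have h2 : ContDiffAt ℝ 1 (fun s => A (x s) (u s) (velocity (𝓡 n) x s)) t :=
    ((((contDiffAt_localFormJoint hA (x t) (coordCurve_mem_target x t) (u t)).of_le
      (by simp)).comp t hp).clm_apply hc').congr_of_eventuallyEq (localForm_along hx u)
  exact (h1.mul contDiffAt_const).add h2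

include hH hA in
theorem continuousAt_nullForce (hx : ContMDiffAt 𝓘(ℝ, ℝ) (𝓡 n) 2 x t)
    (hu : ContinuousAt u t) (b : ℝ) :
    ContinuousAt (fun s => nullForce H A b (x s) (u s) (velocity (𝓡 n) x s)) t := by
  have hc := contDiffAt_coordCurve hx
  have hc' : ContinuousAt (deriv (coordCurve n x t)) t :=
    (hasDerivAt_and_hasDerivAt_deriv hc).2.continuousAt
  have hp : ContinuousAt (fun s => (coordCurve n x t s, u s)) t := hc.continuousAt.prodMk hu
  have h1 : ContinuousAt (fun s => fderiv ℝ (localFunction H (x t)) (coordCurve n x t s, u s)) t :=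
    ContinuousAt.comp (f := fun s => (coordCurve n x t s, u s))
      ((contDiffAt_localFunction hH (x t) (coordCurve_mem_target x t) (u t)).fderiv_right
        (m := 0) (by simp)).continuousAt hp
  have h2 : ContinuousAt (fun s => fderiv ℝ (localFormJoint A (x t)) (coordCurve n x t s, u s)) t :=
    ContinuousAt.comp (f := fun s => (coordCurve n x t s, u s))
      ((contDiffAt_localFormJoint hA (x t) (coordCurve_mem_target x t) (u t)).fderiv_right
        (m := 0) (by simp)).continuousAt hp
  refine ContinuousAt.congr ?_ (nullForce_along hH hA hx u fun _ => b).symm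
  exact (continuousAt_const.mul (h1.clm_apply continuousAt_const)).add
    (continuousAt_const.mul ((h2.clm_apply continuousAt_const).clm_apply hc'))

include hH hA in
/-- If the equations tested against `∂_r` and the tangent space of `N` hold, the energy changes at twice
the rate of `u'` times the defect in the remaining equation. -/
theorem hasDerivAt_energy (hx : ContMDiffAt 𝓘(ℝ, ℝ) (𝓡 n) 2 x t)
    (hu : ContDiffAt ℝ 2 u t) (hr : ContDiffAt ℝ 2 r t) (hu₂ : deriv (deriv u) t = 0)
    (hx₂ : covAccel h.inner x t =
      force h.inner H A (deriv u t) (x t) (u t) (velocity (𝓡 n) x t)) :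
    HasDerivAt (fun s => h.inner (x s) (velocity (𝓡 n) x s) (velocity (𝓡 n) x s)
        - 2 * (deriv u s * deriv r s) + H (x s, u s) * deriv u s ^ 2
        + 2 * (deriv u s * A (x s) (u s) (velocity (𝓡 n) x s)))
      (2 * (deriv u t * nullDefect H A (x t) (coordCurve n x t t) (deriv (coordCurve n x t) t)
        (deriv (deriv (coordCurve n x t)) t) (u t) (deriv u t) (deriv (deriv u) t)
        (deriv (deriv r) t))) t := by
  have hS := (covAccel_eq_force_iff h hH hA x t _ _ hx).1 hx₂ (deriv (coordCurve n x t) t)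
  have hu' := (hasDerivAt_and_hasDerivAt_deriv hu).2
  have hHt : H (x t, u t) = localFunction H (x t) (coordCurve n x t t, u t) :=
    (localFunction_along hx u).self_of_nhds
  have hsplit : ((deriv (coordCurve n x t) t, deriv u t) : EuclideanSpace ℝ (Fin n) × ℝ) =
      (deriv (coordCurve n x t) t, 0) + deriv u t • ((0, 1) : EuclideanSpace ℝ (Fin n) × ℝ) := by
    simp
  refine ((((hasDerivAt_metric_along h hx).sub
    ((hu'.mul (hasDerivAt_and_hasDerivAt_deriv hr).2).const_mul 2)).add
    ((hasDerivAt_function_along hH hx hu).mul (hu'.pow 2))).add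
    ((hu'.mul (hasDerivAt_form_along hA hx hu)).const_mul 2)).congr_deriv ?_
  rw [spatialDefect, hsplit, map_add, map_smul] at hS
  simp only [add_apply, smul_apply, smul_eq_mul] at hS
  rw [hu₂, nullDefect, hHt, hsplit, map_add, map_add, map_smul, map_smul]
  simp only [add_apply, smul_apply, smul_eq_mul]
  norm_num
  linear_combination 2 * hS

end Curve

end

/-! ### Geodesics on an open interval, and completeness -/

section

section Germ

variable {E : Type*} [NormedAddCommGroup E] [NormedSpace ℝ E]
  {B : Type*} [TopologicalSpace B] {I : ModelWithCorners ℝ E B}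
  {M : Type*} [TopologicalSpace M] [ChartedSpace B M]

/-- The covariant acceleration depends only on the germ of the curve. -/
theorem covAccel_congr (g : MetricField I (M := M)) {γ γ' : ℝ → M} {t : ℝ}
    (hγ : γ =ᶠ[nhds t] γ') : (covAccel g γ t : E) = covAccel g γ' t := by
  have key : ∀ p : M,
      deriv (deriv fun s => extChartAt I p (γ s)) t + christoffel g p (extChartAt I p (γ t))
        (deriv (fun s => extChartAt I p (γ s)) t) (deriv (fun s => extChartAt I p (γ s)) t) =
      deriv (deriv fun s => extChartAt I p (γ' s)) t + christoffel g p (extChartAt I p (γ' t))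
        (deriv (fun s => extChartAt I p (γ' s)) t) (deriv (fun s => extChartAt I p (γ' s)) t) := by
    intro p
    have h1 : (fun s => extChartAt I p (γ s)) =ᶠ[nhds t] fun s => extChartAt I p (γ' s) :=
      hγ.fun_comp (extChartAt I p)
    rw [h1.deriv.deriv_eq, h1.deriv_eq, hγ.self_of_nhds]
  refine (key (γ t)).trans ?_
  rw [hγ.self_of_nhds]
  rfl

theorem IsGeodesicOn.congr {g : MetricField I (M := M)} {γ γ' : ℝ → M} {J : Set ℝ} (hJ : IsOpen J)
    (h : IsGeodesicOn g γ J) (heq : EqOn γ γ' J) : IsGeodesicOn g γ' J :=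
  ⟨h.1.congr fun _ hs => (heq hs).symm, fun s hs =>
    (covAccel_congr g (heq.eventuallyEq_of_mem (hJ.mem_nhds hs))).symm.trans (h.2 s hs)⟩

theorem IsGeodesicOn.mono {g : MetricField I (M := M)} {γ : ℝ → M} {J J' : Set ℝ}
    (h : IsGeodesicOn g γ J) (hJ : J' ⊆ J) : IsGeodesicOn g γ J' :=
  ⟨h.1.mono hJ, fun s hs => h.2 s (hJ hs)⟩

end Germ

variable {n : ℕ} {N : Type*} [TopologicalSpace N] [ChartedSpace (EuclideanSpace ℝ (Fin n)) N]

/-- The equation of motion at `s` depends only on the germ of the curve at `s`. -/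
theorem trajectory_germ {h : MetricField (𝓡 n) (M := N)} {H : N × ℝ → ℝ} {A : OneForm n N}
    {b u : ℝ} {x x' : ℝ → N} {s : ℝ} (hx : x =ᶠ[nhds s] x')
    (h1 : covAccel h x s = force h H A b (x s) u (velocity (𝓡 n) x s)) :
    covAccel h x' s = force h H A b (x' s) u (velocity (𝓡 n) x' s) := by
  have hv : (velocity (𝓡 n) x s : EuclideanSpace ℝ (Fin n)) = velocity (𝓡 n) x' s := by
    rw [velocity, hx.mfderiv_eq]
    rfl
  have key : ∀ q, x s = q → ∀ v : EuclideanSpace ℝ (Fin n),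
      (force h H A b (x s) u v : EuclideanSpace ℝ (Fin n)) = force h H A b q u v := by
    rintro q rfl v; rfl
  refine (covAccel_congr h hx).symm.trans (h1.trans ((key _ hx.self_of_nhds _).trans ?_))
  rw [hv]

theorem IsTrajectoryOn.congr {h : MetricField (𝓡 n) (M := N)} {H : N × ℝ → ℝ} {A : OneForm n N}
    {u₀ b : ℝ} {x x' : ℝ → N} {J : Set ℝ} (hJ : IsOpen J)
    (hx : IsTrajectoryOn h H A u₀ b x J) (heq : EqOn x x' J) :
    IsTrajectoryOn h H A u₀ b x' J :=
  ⟨hx.1.congr fun _ hs => (heq hs).symm, fun s hs =>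
    trajectory_germ (heq.eventuallyEq_of_mem (hJ.mem_nhds hs)) (hx.2 s hs)⟩

theorem isTrajectoryOn_iff {h : MetricField (𝓡 n) (M := N)} {H : N × ℝ → ℝ} {A : OneForm n N}
    {u₀ b : ℝ} (x : ℝ → N) {J : Set ℝ} (hJ : IsOpen J) :
    IsTrajectoryOn h H A u₀ b x J ↔ ∀ s ∈ J, ContMDiffAt 𝓘(ℝ, ℝ) (𝓡 n) 2 x s ∧
      covAccel h x s = force h H A b (x s) (u₀ + s * b) (velocity (𝓡 n) x s) :=
  ⟨fun hx s hs => ⟨hx.1.contMDiffAt (hJ.mem_nhds hs), hx.2 s hs⟩,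
    fun hx => ⟨fun s hs => (hx s hs).1.contMDiffWithinAt, fun s hs => (hx s hs).2⟩⟩

theorem contMDiffOn_spacetime_iff {x : ℝ → N} {u r : ℝ → ℝ} {J : Set ℝ} :
    ContMDiffOn 𝓘(ℝ, ℝ) (spacetimeModel n) 2 (fun s => (x s, (u s, r s))) J ↔
      ContMDiffOn 𝓘(ℝ, ℝ) (𝓡 n) 2 x J ∧ ContDiffOn ℝ 2 u J ∧ ContDiffOn ℝ 2 r J := by
  rw [contMDiffOn_prod_iff, contMDiffOn_prod_iff, ← contMDiffOn_iff_contDiffOn,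
    ← contMDiffOn_iff_contDiffOn]
  rfl

variable [IsManifold (𝓡 n) ∞ N]
  (h : ContMDiffRiemannianMetric (𝓡 n) ∞ (EuclideanSpace ℝ (Fin n))
    (fun x : N => TangentSpace (𝓡 n) x))
  {H : N × ℝ → ℝ} (hH : ContMDiff ((𝓡 n).prod 𝓘(ℝ, ℝ)) 𝓘(ℝ, ℝ) ∞ H)
  {A : OneForm n N} (hA : A.IsSmooth)

omit [IsManifold (𝓡 n) ∞ N] in
/-- The energy of a curve in terms of its components. -/
theorem energy_eq (h : MetricField (𝓡 n) (M := N)) (H : N × ℝ → ℝ) (A : OneForm n N)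
    {x : ℝ → N} {u r : ℝ → ℝ} {s : ℝ} (hx : MDifferentiableAt 𝓘(ℝ, ℝ) (𝓡 n) x s)
    (hu : DifferentiableAt ℝ u s) (hr : DifferentiableAt ℝ r s) :
    ppMetric h H A (x s, (u s, r s))
      (velocity (spacetimeModel n) (fun s => (x s, (u s, r s))) s)
      (velocity (spacetimeModel n) (fun s => (x s, (u s, r s))) s) =
    h (x s) (velocity (𝓡 n) x s) (velocity (𝓡 n) x s) - 2 * (deriv u s * deriv r s)
      + H (x s, u s) * deriv u s ^ 2
      + 2 * (deriv u s * A (x s) (u s) (velocity (𝓡 n) x s)) := by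
  have hv := velocity_spacetime (n := n) hx hu hr
  have h1 := ppMetric_apply h H A (x s) (u s) (r s) (velocity (𝓡 n) x s) (velocity (𝓡 n) x s)
    (deriv u s) (deriv u s) (deriv r s) (deriv r s)
  have h2 : ppMetric h H A (x s, (u s, r s))
      (velocity (spacetimeModel n) (fun s => (x s, (u s, r s))) s)
      (velocity (spacetimeModel n) (fun s => (x s, (u s, r s))) s) = _ :=
    (congrArg₂ (fun v w : EuclideanSpace ℝ (Fin n) × (ℝ × ℝ) =>
      ppMetric h H A (x s, (u s, r s)) v w) hv hv).trans h1
  rw [h2]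
  ring

include hH hA in
/-- The geodesics of the pp-wave metric: `u` is affine, `x` is a trajectory, and the momentum is
balanced. The speed `b` of `u` may vanish. -/
theorem isGeodesicOn_spacetime_iff {J : Set ℝ} (hJ : IsOpenInterval J) (x : ℝ → N)
    (u r : ℝ → ℝ) :
    IsGeodesicOn (ppMetric h.inner H A) (fun s => (x s, (u s, r s))) J ↔
      ∃ u₀ b, (∀ s ∈ J, u s = u₀ + s * b) ∧ IsTrajectoryOn h.inner H A u₀ b x J ∧
        ContDiffOn ℝ 2 r J ∧ ∀ s ∈ J,
          HasDerivAt (fun s => H (x s, u₀ + s * b) * b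
              + A (x s) (u₀ + s * b) (velocity (𝓡 n) x s) - deriv r s)
            (nullForce H A b (x s) (u₀ + s * b) (velocity (𝓡 n) x s)) s := by
  have hnhds : ∀ s ∈ J, J ∈ nhds s := fun s hs => hJ.1.mem_nhds hs
  have hmom : ∀ {u₀ b}, (∀ s ∈ J, u s = u₀ + s * b) → ContMDiffOn 𝓘(ℝ, ℝ) (𝓡 n) 2 x J →
      ContDiffOn ℝ 2 u J → ContDiffOn ℝ 2 r J → ∀ s ∈ J,
      HasDerivAt (fun s => H (x s, u₀ + s * b) * b
              + A (x s) (u₀ + s * b) (velocity (𝓡 n) x s) - deriv r s)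
        (nullDefect H A (x s) (coordCurve n x s s) (deriv (coordCurve n x s) s)
        (deriv (deriv (coordCurve n x s)) s) (u s) (deriv u s) (deriv (deriv u) s)
        (deriv (deriv r) s) + nullForce H A b (x s) (u₀ + s * b) (velocity (𝓡 n) x s)) s := by
    intro u₀ b hu hx hu2 hr s hs
    obtain ⟨e0, e1⟩ := deriv_of_eqOn_affine hJ.1 hu hs
    have := hasDerivAt_momentum hH hA (hx.contMDiffAt (hnhds s hs))
      (hu2.contDiffAt (hnhds s hs)) (hr.contDiffAt (hnhds s hs))
    have hn : nullForce H A b (x s) (u₀ + s * b) (velocity (𝓡 n) x s) =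
        nullForce H A (deriv u s) (x s) (u s) (velocity (𝓡 n) x s) := by
      rw [e1.self_of_nhds, hu s hs]
    rw [hn]
    refine this.congr_of_eventuallyEq ?_
    filter_upwards [e0, e1] with σ h0 h1
    rw [h0, h1]
  constructor
  · rintro ⟨hreg, hgeo⟩
    obtain ⟨hx, hu2, hr⟩ := contMDiffOn_spacetime_iff.1 hreg
    have hpt := fun s hs => (covAccel_ppMetric_eq_zero_iff h hH hA (hx.contMDiffAt (hnhds s hs))
      (hu2.contDiffAt (hnhds s hs)) (hr.contDiffAt (hnhds s hs))).1 (hgeo s hs)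
    obtain ⟨u₀, b, hu⟩ := eqOn_affine hJ hu2 fun s hs => (hpt s hs).1
    refine ⟨u₀, b, hu, ⟨hx, fun s hs => ?_⟩, hr, fun s hs => ?_⟩
    · have := (hpt s hs).2.1
      rwa [(deriv_of_eqOn_affine hJ.1 hu hs).2.self_of_nhds, hu s hs] at this
    · simpa [(hpt s hs).2.2] using hmom hu hx hu2 hr s hs
  · rintro ⟨u₀, b, hu, ⟨hx, hacc⟩, hr, hm⟩
    have hu2 : ContDiffOn ℝ 2 u J :=
      ContDiffOn.congr (by fun_prop) hu
    refine ⟨contMDiffOn_spacetime_iff.2 ⟨hx, hu2, hr⟩, fun s hs => ?_⟩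
    obtain ⟨e0, e1⟩ := deriv_of_eqOn_affine hJ.1 hu hs
    refine (covAccel_ppMetric_eq_zero_iff h hH hA (hx.contMDiffAt (hnhds s hs))
      (hu2.contDiffAt (hnhds s hs)) (hr.contDiffAt (hnhds s hs))).2 ⟨?_, ?_, ?_⟩
    · rw [e1.deriv_eq]
      simp
    · rw [e1.self_of_nhds, hu s hs]
      exact hacc s hs
    · have := (hmom hu hx hu2 hr s hs).unique (hm s hs)
      linarith

include hH hA in
/-- Every trajectory lifts to a geodesic over the same interval, with prescribed initial data for `r`. -/
theorem IsTrajectoryOn.exists_isGeodesicOn {J : Set ℝ} (hJ : IsOpenInterval J) {u₀ b : ℝ}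
    {x : ℝ → N} (hx : IsTrajectoryOn h.inner H A u₀ b x J) {s₀ : ℝ} (hs₀ : s₀ ∈ J) (r₀ r₁ : ℝ) :
    ∃ r : ℝ → ℝ, r s₀ = r₀ ∧ deriv r s₀ = r₁ ∧
      IsGeodesicOn (ppMetric h.inner H A) (fun s => (x s, (u₀ + s * b, r s))) J := by
  have hx' : ∀ s ∈ J, ContMDiffAt 𝓘(ℝ, ℝ) (𝓡 n) 2 x s := fun s hs =>
    hx.1.contMDiffAt (hJ.1.mem_nhds hs)
  obtain ⟨r, h0, h1, h2, h3⟩ := exists_contDiffOn_two hJ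
    (m := fun s => H (x s, u₀ + s * b) * b + A (x s) (u₀ + s * b) (velocity (𝓡 n) x s))
    (f := fun s => nullForce H A b (x s) (u₀ + s * b) (velocity (𝓡 n) x s))
    (fun s hs => (contDiffAt_momentum hH hA (hx' s hs) (u := fun s => u₀ + s * b)
      (by fun_prop) b).contDiffWithinAt)
    (fun s hs => (continuousAt_nullForce hH hA (hx' s hs) (u := fun s => u₀ + s * b)
      (by fun_prop) b).continuousWithinAt) hs₀ r₀ r₁
  exact ⟨r, h0, h1, (isGeodesicOn_spacetime_iff h hH hA hJ x _ r).2
    ⟨u₀, b, fun s _ => rfl, hx, h2, h3⟩⟩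

include hH hA in
/-- The lift of a trajectory to a geodesic is determined by the initial data of `r`. -/
theorem IsGeodesicOn.eqOn_null {J : Set ℝ} (hJ : IsOpenInterval J) {x : ℝ → N} {u r r' : ℝ → ℝ}
    (hr : IsGeodesicOn (ppMetric h.inner H A) (fun s => (x s, (u s, r s))) J)
    (hr' : IsGeodesicOn (ppMetric h.inner H A) (fun s => (x s, (u s, r' s))) J)
    {s₀ : ℝ} (hs₀ : s₀ ∈ J) (h0 : r s₀ = r' s₀) (h1 : deriv r s₀ = deriv r' s₀) :
    EqOn r r' J := by
  obtain ⟨u₀, b, hu, -, hr2, hm⟩ := (isGeodesicOn_spacetime_iff h hH hA hJ x u r).1 hr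
  obtain ⟨u₁, b₁, hu', -, hr2', hm'⟩ := (isGeodesicOn_spacetime_iff h hH hA hJ x u r').1 hr'
  obtain ⟨rfl, rfl⟩ := affine_unique hJ fun s hs => (hu s hs).symm.trans (hu' s hs)
  have hd := eqOn_of_hasDerivAt hJ hm hm' hs₀ (by simp [h1])
  refine eqOn_of_hasDerivAt hJ (f' := deriv r) (fun s hs => ?_) (fun s hs => ?_) hs₀ h0
  · exact ((hr2.differentiableOn (by simp)).differentiableAt (hJ.1.mem_nhds hs)).hasDerivAt
  · have : deriv r s = deriv r' s := by simpa using hd hs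
    rw [this]
    exact ((hr2'.differentiableOn (by simp)).differentiableAt (hJ.1.mem_nhds hs)).hasDerivAt

include hH hA in
theorem complete_iff :
    AllInextendibleComplete (IsGeodesicOn (ppMetric h.inner H A)) ↔
      ∀ u₀ du₀ : ℝ, AllInextendibleComplete (IsTrajectoryOn h.inner H A u₀ du₀) := by
  constructor
  · rintro hM u₀ b x J ⟨hJ, hx, hmax⟩
    obtain ⟨s₀, hs₀⟩ := hJ.2.2
    obtain ⟨r, -, -, hγ⟩ := hx.exists_isGeodesicOn h hH hA hJ hs₀ 0 0
    refine hM _ J ⟨hJ, hγ, fun γ' J' hJ' hsub hγ' heq => ?_⟩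
    obtain ⟨u₁, b₁, hu, hx', -⟩ := (isGeodesicOn_spacetime_iff h hH hA hJ' (fun s => (γ' s).1)
      (fun s => (γ' s).2.1) (fun s => (γ' s).2.2)).1 hγ'
    obtain ⟨rfl, rfl⟩ := affine_unique hJ fun s hs =>
      (congrArg (fun p : N × (ℝ × ℝ) => p.2.1) (heq hs)).trans (hu s (hsub hs))
    exact hmax _ J' hJ' hsub hx' fun s hs => congrArg Prod.fst (heq hs)
  · rintro hN γ J ⟨hJ, hγ, hmax⟩
    obtain ⟨s₀, hs₀⟩ := hJ.2.2
    obtain ⟨u₀, b, hu, hx, -⟩ := (isGeodesicOn_spacetime_iff h hH hA hJ (fun s => (γ s).1)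
      (fun s => (γ s).2.1) (fun s => (γ s).2.2)).1 hγ
    obtain ⟨x, J', hsub, heq, hinext⟩ := exists_inextendible_extension
      (fun x J hJ => isTrajectoryOn_iff (h := h.inner) (H := H) (A := A) (u₀ := u₀) (b := b) x hJ)
      (fun c c' s hcc hc => ⟨hc.1.congr_of_eventuallyEq hcc.symm, trajectory_germ hcc hc.2⟩)
      hJ hx
    obtain rfl := hN u₀ b x J' hinext
    obtain ⟨r, hr0, hr1, hgeo⟩ := hinext.2.1.exists_isGeodesicOn h hH hA hinext.1 (mem_univ s₀)
      (γ s₀).2.2 (deriv (fun s => (γ s).2.2) s₀)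
    -- Over `J` the new lift and the given geodesic are lifts of the same trajectory.
    have hgeoJ : IsGeodesicOn (ppMetric h.inner H A)
        (fun s => ((γ s).1, ((γ s).2.1, r s))) J :=
      (hgeo.mono (subset_univ J)).congr hJ.1 fun s hs =>
        Prod.ext (heq hs).symm (Prod.ext (hu s hs).symm rfl)
    have hr := IsGeodesicOn.eqOn_null h hH hA hJ (x := fun s => (γ s).1)
      (u := fun s => (γ s).2.1) (r := fun s => (γ s).2.2) hγ hgeoJ hs₀ hr0.symm hr1.symm
    exact (hmax _ univ hinext.1 (subset_univ J) hgeo fun s hs =>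
      Prod.ext (heq hs) (Prod.ext (hu s hs) (hr hs))).symm

end

/-! ### Geodesics of prescribed energy -/

section

variable {n : ℕ} {N : Type*} [TopologicalSpace N] [ChartedSpace (EuclideanSpace ℝ (Fin n)) N]
  [IsManifold (𝓡 n) ∞ N]
  (h : ContMDiffRiemannianMetric (𝓡 n) ∞ (EuclideanSpace ℝ (Fin n))
    (fun x : N => TangentSpace (𝓡 n) x))
  {H : N × ℝ → ℝ} (hH : ContMDiff ((𝓡 n).prod 𝓘(ℝ, ℝ)) 𝓘(ℝ, ℝ) ∞ H)
  {A : OneForm n N} (hA : A.IsSmooth)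

section FixedEnergy

variable {J : Set ℝ} (hJ : IsOpenInterval J) {x : ℝ → N} {u r : ℝ → ℝ}
  (hreg : ContMDiffOn 𝓘(ℝ, ℝ) (spacetimeModel n) 2 (fun s => (x s, (u s, r s))) J) {e : ℝ}
  (he : ∀ s ∈ J, ppMetric h.inner H A (x s, (u s, r s))
    (velocity (spacetimeModel n) (fun s => (x s, (u s, r s))) s)
    (velocity (spacetimeModel n) (fun s => (x s, (u s, r s))) s) = e)

include hreg he hJ in
theorem energy_eqOn {s : ℝ} (hs : s ∈ J) :
    h.inner (x s) (velocity (𝓡 n) x s) (velocity (𝓡 n) x s) - 2 * (deriv u s * deriv r s)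
      + H (x s, u s) * deriv u s ^ 2
      + 2 * (deriv u s * A (x s) (u s) (velocity (𝓡 n) x s)) = e := by
  obtain ⟨hx, hu, hr⟩ := contMDiffOn_spacetime_iff.1 hreg
  have hnhds := hJ.1.mem_nhds hs
  rw [← he s hs]
  exact (energy_eq h.inner H A ((hx.contMDiffAt hnhds).mdifferentiableAt (by simp))
    ((hu.contDiffAt hnhds).differentiableAt (by simp))
    ((hr.contDiffAt hnhds).differentiableAt (by simp))).symm

include hreg he hJ in
/-- Solving the energy for `r'` and integrating. -/
theorem null_eq_integral (h0 : (0 : ℝ) ∈ J) {u₀ b : ℝ} (hb : b ≠ 0)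
    (hu : ∀ s ∈ J, u s = u₀ + s * b) {s : ℝ} (hs : s ∈ J) :
    r s = r 0 - 1 / (2 * b) * ∫ σ in (0 : ℝ)..s,
      (e - h.inner (x σ) (velocity (𝓡 n) x σ) (velocity (𝓡 n) x σ)
        - b ^ 2 * H (x σ, u σ) - 2 * b * A (x σ) (u σ) (velocity (𝓡 n) x σ)) := by
  obtain ⟨hx, hu2, hr⟩ := contMDiffOn_spacetime_iff.1 hreg
  have hsub : uIcc 0 s ⊆ J := hJ.2.1.uIcc_subset h0 hs
  have hr' : ∀ σ ∈ J, e - h.inner (x σ) (velocity (𝓡 n) x σ) (velocity (𝓡 n) x σ)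
      - b ^ 2 * H (x σ, u σ) - 2 * b * A (x σ) (u σ) (velocity (𝓡 n) x σ) =
      -(2 * b) * deriv r σ := by
    intro σ hσ
    have := energy_eqOn h hJ hreg he hσ
    rw [(deriv_of_eqOn_affine hJ.1 hu hσ).2.self_of_nhds] at this
    linear_combination -this
  have hcont : ContinuousOn (deriv r) J := hr.continuousOn_deriv_of_isOpen hJ.1 (by norm_num)
  rw [intervalIntegral.integral_congr fun σ hσ => hr' σ (hsub hσ),
    intervalIntegral.integral_const_mul,
    intervalIntegral.integral_eq_sub_of_hasDerivAt (f := r) (fun σ hσ =>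
      ((hr.differentiableOn (by simp)).differentiableAt (hJ.1.mem_nhds (hsub hσ))).hasDerivAt)
      (hcont.mono hsub).intervalIntegrable]
  field_simp
  ring

include hreg he hJ hH hA in
/-- With nonzero speed of `u`, constant energy makes the momentum balance hold automatically. -/
theorem isGeodesicOn_of_trajectory {u₀ b : ℝ} (hb : b ≠ 0) (hu : ∀ s ∈ J, u s = u₀ + s * b)
    (hx : IsTrajectoryOn h.inner H A u₀ b x J) :
    IsGeodesicOn (ppMetric h.inner H A) (fun s => (x s, (u s, r s))) J := by
  obtain ⟨hx2, hu2, hr⟩ := contMDiffOn_spacetime_iff.1 hreg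
  refine ⟨hreg, fun s hs => ?_⟩
  have hnhds := hJ.1.mem_nhds hs
  have hu' := (deriv_of_eqOn_affine hJ.1 hu hs).2
  have hu'' : deriv (deriv u) s = 0 := by
    rw [hu'.deriv_eq]
    simp
  have hacc : covAccel h.inner x s =
      force h.inner H A (deriv u s) (x s) (u s) (velocity (𝓡 n) x s) := by
    rw [hu'.self_of_nhds, hu s hs]
    exact hx.2 s hs
  refine (covAccel_ppMetric_eq_zero_iff h hH hA (hx2.contMDiffAt hnhds) (hu2.contDiffAt hnhds)
    (hr.contDiffAt hnhds)).2 ⟨hu'', hacc, ?_⟩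
  have hE := hasDerivAt_energy h hH hA (hx2.contMDiffAt hnhds) (hu2.contDiffAt hnhds)
    (hr.contDiffAt hnhds) hu'' hacc
  have hE' := (hasDerivAt_const s e).congr_of_eventuallyEq
    (Filter.eventuallyEq_of_mem hnhds fun σ hσ => energy_eqOn h hJ hreg he hσ)
  have := hE.unique hE'
  rw [hu'.self_of_nhds] at this ⊢
  simpa [hb] using this

end FixedEnergy

end

end PPWave

end

theorem proposition3p1 {n : ℕ} {N : Type*} [TopologicalSpace N] [T2Space N]
    [SecondCountableTopology N] [ConnectedSpace N]
    [ChartedSpace (EuclideanSpace ℝ (Fin n)) N] [IsManifold (𝓡 n) ∞ N]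
    (h : ContMDiffRiemannianMetric (𝓡 n) ∞ (EuclideanSpace ℝ (Fin n))
      (fun x : N => TangentSpace (𝓡 n) x))
    (H : N × ℝ → ℝ) (hH : ContMDiff ((𝓡 n).prod 𝓘(ℝ, ℝ)) 𝓘(ℝ, ℝ) ∞ H)
    (A : PPWave.OneForm n N) (hA : A.IsSmooth) :
    -- form of the geodesics
    (∀ (J : Set ℝ), PPWave.IsOpenInterval J → (0 : ℝ) ∈ J →
      ∀ (x : ℝ → N) (u r : ℝ → ℝ),
        ContMDiffOn 𝓘(ℝ, ℝ) (PPWave.spacetimeModel n) 2 (fun s => (x s, (u s, r s))) J →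
      ∀ (Eγ : ℝ),
        (∀ s ∈ J, PPWave.ppMetric h.inner H A (x s, (u s, r s))
          (PPWave.velocity (PPWave.spacetimeModel n) (fun s => (x s, (u s, r s))) s)
          (PPWave.velocity (PPWave.spacetimeModel n) (fun s => (x s, (u s, r s))) s) = Eγ) →
      ∀ (u₀ r₀ du₀ : ℝ), u 0 = u₀ → r 0 = r₀ → deriv u 0 = du₀ → du₀ ≠ 0 →
        (PPWave.IsGeodesicOn (PPWave.ppMetric h.inner H A) (fun s => (x s, (u s, r s))) J ↔
          (∀ s ∈ J, u s = u₀ + s * du₀) ∧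
          PPWave.IsTrajectoryOn h.inner H A u₀ du₀ x J ∧
          (∀ s ∈ J, r s = r₀ - 1 / (2 * du₀) * ∫ σ in (0 : ℝ)..s,
            (Eγ - h.inner (x σ) (PPWave.velocity (𝓡 n) x σ) (PPWave.velocity (𝓡 n) x σ)
              - du₀ ^ 2 * H (x σ, u σ)
              - 2 * du₀ * A (x σ) (u σ) (PPWave.velocity (𝓡 n) x σ))))) ∧
    -- basic condition for completeness
    (PPWave.AllInextendibleComplete (PPWave.IsGeodesicOn (PPWave.ppMetric h.inner H A)) ↔
      ∀ u₀ du₀ : ℝ, PPWave.AllInextendibleComplete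
        (PPWave.IsTrajectoryOn h.inner H A u₀ du₀)) := by
  refine ⟨?_, PPWave.complete_iff h hH hA⟩
  intro J hJ h0 x u r hreg e he u₀ r₀ b hu₀ hr₀ hb hb0
  constructor
  · intro hγ
    obtain ⟨u₁, b₁, hu, hx, -⟩ := (PPWave.isGeodesicOn_spacetime_iff h hH hA hJ x u r).1 hγ
    obtain rfl : u₁ = u₀ := by simpa [hu₀] using (hu 0 h0).symm
    obtain rfl : b₁ = b :=
      (PPWave.deriv_of_eqOn_affine hJ.1 hu h0).2.self_of_nhds.symm.trans hb
    refine ⟨hu, hx, fun s hs => ?_⟩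
    rw [← hr₀]
    exact PPWave.null_eq_integral h hJ hreg he h0 hb0 hu hs
  · rintro ⟨hu, hx, -⟩
    exact PPWave.isGeodesicOn_of_trajectory h hH hA hJ hreg he hb0 hu hx
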